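/- Fix an integer $d\ge 2$, let $\mathbb T\subset\mathbb C$ be the unit circle, $h(z)=z^d$, and let $\alpha\in\mathbb T$. Call $\alpha$ pre-periodic if some $h^m(\alpha)$, $m\ge 0$, is periodic under $h$. *Itineraries.* Let $\star_1,\dots,\star_d$ ($\star_{d+1}=\star_1$) be the roots of $z^d=\alpha$ in counterclockwise order from $1$. The itinerary $I^\alpha(x)$ of $x\in\mathbb T$ is the infinite word whose $n$-th digit ($n\ge1$) is $\star$ if $h^{n-1}(x)\in\{\star_1,\dots,\star_d\}$, and $L_i$ if $h^{n-1}(x)$ lies in the open arc from $\star_i$ to $\star_{i+1}$. Let $\approx_\alpha$ be the equivalence relation on $\mathbb T$ generated by the pairs $(x,y)$ such that for every $n\ge 1$ either $I^\alpha(x)[n]=I^\alpha(y)[n]$ or one of these two digits is $\star$. Let $\widetilde L_i$ be the inverse branch of $h$ from $\mathbb T\setminus\{\alpha\}$ onto the open arc from $\star_i$ to $\star_{i+1}$. *Gluing links.* A gluing link is a union of finitely many (at least one) disjoint closed arcs (possibly single points) with end points $a_1,b_1,\dots,a_m,b_m$ in counterclockwise order, the $i$-th arc running from $a_i$ to $b_i$,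 such that $b_i\approx_\alpha a_{i+1}$ for all $i$ (with $a_{m+1}=a_1$). A cover by gluing links is a family $\{D(x)\}_{x\in\mathbb T}$ of gluing links with $x\in D(x)$. The $\alpha$-components of $h^{-n}(D)$ are defined recursively: $D$ is the only one for $n=0$; a component $F$ of $h^{-n}(D)$ gives rise to the components $\widetilde L_1(F),\dots,\widetilde L_d(F)$ of $h^{-(n+1)}(D)$ if $\alpha\notin F$, and to the single component $h^{-1}(F)$ if $\alpha\in F$. Let $D^{(n)}(x)$ be the $\alpha$-component of $h^{-n}(D(h^n(x)))$ containing $x$, and define the encounter number $$N(x,n)=\#\{1\le i\le n:\ \alpha\in D^{(n-i)}(h^i(x))\}.$$ The cover is $L$-digit-fixing if for all $n\ge0$, $y\in\mathbb T$ and $x_1,x_2\in D^{(n)}(y)$, any two distinct positions in $\{1,\dots,n+1\}$ at which $I^\alpha(x_1)$ and $I^\alpha(x_2)$ differ are more than $L$ apart. *Semi-CCE.* $\alpha$ satisfies the semi-CCE condition if there are positive integers $L,P$ and an integer $M\ge0$ such that for every $L$-digit-fixing cover by gluing links and every $x\in\mathbb T$ there are positive integers $n_1<n_2<\cdots$ with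 $n_j\le Pj$ and $N(x,n_j)\le M$ for all $j\ge 1$. *Strong recurrence.* A set $\mathcal R\subseteq\mathbb N$ is $D$-rare if $\#(\mathcal R\cap[i,i+D])\le 3$ for all $i\in\mathbb N$. An interval $[a,b]$ with $1<a\le b$ is $\mathcal R$-duplicating if $I^\alpha(\alpha)[m]=I^\alpha(\alpha)[m-a+1]$ for all $m\in[a,b]\setminus\mathcal R$. $\alpha$ is strongly recurrent if for every integer $D>0$ and real $\tau<1$ there are an integer $n>D$ and a $D$-rare set $\mathcal R\subseteq\{1,\dots,n\}$ such that more than $\tau n$ of the integers $i\in\{1,\dots,n\}$ lie in some $\mathcal R$-duplicating interval $[a,b]\subseteq[1,n]$ with $b=n$ or with $b-a+1>D$. **Theorem.** (1) If $\alpha\in\mathbb T$ is not pre-periodic and does not satisfy the semi-CCE condition, then $\alpha$ is strongly recurrent. (2) The set of $\alpha\in\mathbb T$ that do not satisfy the semi-CCE condition has Hausdorff dimension zero. -/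

import Mathlib

namespace UnicriticalLamination

open Set Function

/-! ## The power map, arcs and the inverse branches -/

/-- The map `h(z) = z ^ d` of the unit circle. -/
noncomputable def powMap (d : ℕ) (z : Circle) : Circle := z ^ d

/-- `α` is pre-periodic under `h`: some iterate of `α` is a periodic point of `h`
(periodic points are included). -/
def IsPreperiodic (d : ℕ) (α : Circle) : Prop :=
  ∃ m : ℕ, (powMap d)^[m] α ∈ periodicPts (powMap d)

/-- The closed arc going counterclockwise from `a` to `b`; it is `{a}` when `a = b`. -/
def closedArc (a b : Circle) : Set Circle :=
  {z | Circle.angleDiff a z ≤ Circle.angleDiff a b}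

/-- The open arc going counterclockwise from `a` to `b` (both end points removed). -/
def openArc (a b : Circle) : Set Circle :=
  {z | 0 < Circle.angleDiff a z ∧ Circle.angleDiff a z < Circle.angleDiff a b}

/-- The `d` roots of `z ^ d = α`, listed counterclockwise starting from `1`. The index runs
cyclically: `star d α 0, …, star d α (d - 1)` are the `d` roots and `star d α d` is the first one
again. -/
noncomputable def star (d : ℕ) (α : Circle) (k : ℕ) : Circle :=
  Circle.exp ((Circle.angleDiff 1 α + 2 * Real.pi * k) / d)

/-- The `d` open arcs between consecutive roots. -/
noncomputable def sector (d : ℕ) (α : Circle) (i : Fin d) : Set Circle :=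
  openArc (star d α i) (star d α (i + 1))

/-- For a set `E` with `α ∉ E`, the image of `E` under the inverse branch of `h` that maps
the complement of `α` onto the `i`-th open arc. -/
def branchImage (d : ℕ) (α : Circle) (i : Fin d) (E : Set Circle) : Set Circle :=
  {w | w ∈ sector d α i ∧ powMap d w ∈ E}

lemma angleDiff_exp_exp {s t : ℝ} (h0 : 0 ≤ t - s) (h1 : t - s < 2 * Real.pi) :
    Circle.angleDiff (Circle.exp s) (Circle.exp t) = t - s := by
  have key : Circle.exp (Circle.angleDiff (Circle.exp s) (Circle.exp t)) = Circle.exp (t - s) := by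
    rw [Circle.exp_sub, eq_div_iff_mul_eq']
    exact Circle.exp_angleDiff_mul
  exact Circle.exp_injOn_Ico (a := 0) (b := 2 * Real.pi) (by simp)
    ⟨Circle.angleDiff_nonneg _ _, Circle.angleDiff_lt_two_pi _ _⟩ ⟨h0, h1⟩ key

/-- Membership in a sector in terms of the angle measured from the first root. -/
lemma exp_mem_sector_iff {d : ℕ} (hd : 2 ≤ d) (α : Circle) (i : Fin d) {u : ℝ}
    (h0 : 0 ≤ u) (h1 : u < 2 * Real.pi) :
    Circle.exp (Circle.angleDiff 1 α / d + u) ∈ sector d α i ↔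
      2 * Real.pi * i < d * u ∧ d * u < 2 * Real.pi * (i + 1) := by
  have hpi := Real.pi_pos
  have hd0 : (2 : ℝ) ≤ d := by exact_mod_cast hd
  have hdp : (0 : ℝ) < d := by linarith
  have hi : ((i : ℕ) : ℝ) + 1 ≤ d := by exact_mod_cast i.2
  have hi0 : (0 : ℝ) ≤ ((i : ℕ) : ℝ) := by positivity
  have e1 : Circle.angleDiff (star d α i) (star d α (i + 1)) = 2 * Real.pi / d := by
    have e : (Circle.angleDiff 1 α + 2 * Real.pi * ((i : ℕ) + 1 : ℕ)) / d -
        (Circle.angleDiff 1 α + 2 * Real.pi * (i : ℕ)) / d = 2 * Real.pi / d := by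
      push_cast; field_simp; ring
    unfold star
    rw [angleDiff_exp_exp, e]
    · rw [e]; positivity
    · rw [e, div_lt_iff₀ hdp]; nlinarith
  set v : ℝ := 2 * Real.pi * i / d with hv
  have hvd : d * v = 2 * Real.pi * i := by rw [hv]; field_simp
  set w : ℝ := 2 * Real.pi / d with hw
  have hwd : d * w = 2 * Real.pi := by rw [hw]; field_simp
  have hwp : 0 < w := by positivity
  have hvp : 0 ≤ v := by positivity
  have hvw : v + w ≤ 2 * Real.pi := by
    have : d * (v + w) ≤ d * (2 * Real.pi) := by rw [mul_add, hvd, hwd]; nlinarith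
    exact le_of_mul_le_mul_left this hdp
  have hs : star d α i = Circle.exp (Circle.angleDiff 1 α / d + v) := by
    unfold star; congr 1; rw [hv]; ring
  have c1 : 2 * Real.pi * i < d * u ↔ v < u := by
    rw [← hvd]; exact mul_lt_mul_iff_right₀ hdp
  have c2 : d * u < 2 * Real.pi * (i + 1) ↔ u < v + w := by
    rw [show 2 * Real.pi * ((i : ℕ) + 1 : ℝ) = d * (v + w) by rw [mul_add, mul_add, hvd, hwd]; ring]
    exact mul_lt_mul_iff_right₀ hdp
  rw [c1, c2]
  change (0 < _ ∧ _ < _) ↔ _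
  rw [e1, hs]
  rcases le_or_gt v u with h | h
  · rw [angleDiff_exp_exp (by linarith) (by linarith)]
    constructor <;> rintro ⟨h3, h4⟩ <;> constructor <;> linarith
  · have : Circle.exp (Circle.angleDiff 1 α / d + u) =
        Circle.exp (Circle.angleDiff 1 α / d + (u + 2 * Real.pi)) := by
      rw [← add_assoc, Circle.exp_add_two_pi]
    rw [this, angleDiff_exp_exp (by linarith) (by linarith)]
    constructor <;> rintro ⟨h3, h4⟩ <;> constructor <;> linarith

lemma exists_exp_eq (d : ℕ) (α z : Circle) : ∃ u : ℝ, 0 ≤ u ∧ u < 2 * Real.pi ∧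
    Circle.exp (Circle.angleDiff 1 α / d + u) = z := by
  refine ⟨Circle.angleDiff (Circle.exp (Circle.angleDiff 1 α / d)) z,
    Circle.angleDiff_nonneg _ _, Circle.angleDiff_lt_two_pi _ _, ?_⟩
  rw [Circle.exp_add, mul_comm]
  exact Circle.exp_angleDiff_mul

/-- The sectors are pairwise disjoint. -/
lemma sector_unique {d : ℕ} (hd : 2 ≤ d) {α z : Circle} {i j : Fin d}
    (hi : z ∈ sector d α i) (hj : z ∈ sector d α j) : i = j := by
  obtain ⟨u, h0, h1, rfl⟩ := exists_exp_eq d α z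
  rw [exp_mem_sector_iff hd α _ h0 h1] at hi hj
  have hpi := Real.two_pi_pos
  have a1 : ((i : ℕ) : ℝ) < (j : ℕ) + 1 := lt_of_mul_lt_mul_left (hi.1.trans hj.2) hpi.le
  have a2 : ((j : ℕ) : ℝ) < (i : ℕ) + 1 := lt_of_mul_lt_mul_left (hj.1.trans hi.2) hpi.le
  have a3 : (i : ℕ) < j + 1 := by exact_mod_cast a1
  have a4 : (j : ℕ) < i + 1 := by exact_mod_cast a2
  exact Fin.ext (by omega)

/-- The sectors cover everything but the `d` roots of `z ^ d = α`. -/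
lemma exists_mem_sector_iff {d : ℕ} (hd : 2 ≤ d) (α z : Circle) :
    (∃ i : Fin d, z ∈ sector d α i) ↔ powMap d z ≠ α := by
  obtain ⟨u, h0, h1, rfl⟩ := exists_exp_eq d α z
  have hpi := Real.two_pi_pos
  have hdp : (0 : ℝ) < d := by exact_mod_cast (by omega : 0 < d)
  have hα : Circle.exp (Circle.angleDiff 1 α) = α := by
    simpa using Circle.exp_angleDiff_mul (x := 1) (y := α)
  have hp : powMap d (Circle.exp (Circle.angleDiff 1 α / d + u)) = α * Circle.exp (d * u) := by
    unfold powMap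
    rw [← Circle.exp_nsmul, nsmul_eq_mul, mul_add, mul_div_cancel₀ _ hdp.ne', Circle.exp_add, hα]
  simp only [exp_mem_sector_iff hd α _ h0 h1]
  rw [hp, Ne, mul_eq_left, Circle.exp_eq_one]
  have hdu : (d * u) / (2 * Real.pi) < d := by
    rw [div_lt_iff₀ hpi]; exact mul_lt_mul_of_pos_left h1 hdp
  have hdu0 : 0 ≤ (d * u) / (2 * Real.pi) := by positivity
  constructor
  · rintro ⟨i, hi1, hi2⟩ ⟨m, hm⟩
    rw [hm, mul_comm (m : ℝ)] at hi1 hi2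
    have b1 := lt_of_mul_lt_mul_left hi1 hpi.le
    have b2 := lt_of_mul_lt_mul_left hi2 hpi.le
    have b3 : ((i : ℕ) : ℤ) < m := by exact_mod_cast b1
    have b4 : m < ((i : ℕ) : ℤ) + 1 := by exact_mod_cast b2
    omega
  · intro hne
    set k := ⌊(d * u) / (2 * Real.pi)⌋₊ with hk
    have hkd : k < d := (Nat.floor_lt hdu0).2 hdu
    refine ⟨⟨k, hkd⟩, ?_, ?_⟩
    · have h2 : (k : ℝ) ≤ _ := Nat.floor_le hdu0
      rw [le_div_iff₀ hpi] at h2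
      refine lt_of_le_of_ne (by simpa [mul_comm] using h2) fun h3 => hne ⟨k, ?_⟩
      rw [← h3]; push_cast; ring
    · have h2 := Nat.lt_floor_add_one ((d * u) / (2 * Real.pi))
      rw [div_lt_iff₀ hpi] at h2
      simpa [mul_comm, hk] using h2

/-! ## Itineraries and the lamination -/

open Classical in
/-- The letter of a point: `none` is the letter `⋆` (the point is a root of `z ^ d = α`) and
`some i` is the letter of the `i`-th open arc. -/
noncomputable def letter (d : ℕ) (α z : Circle) : Option (Fin d) :=
  if h : ∃ i : Fin d, z ∈ sector d α i then some h.choose else none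

/-- The letter of `z` is the index of the sector containing `z`. -/
lemma letter_eq_some_iff {d : ℕ} (hd : 2 ≤ d) (α z : Circle) (i : Fin d) :
    letter d α z = some i ↔ z ∈ sector d α i := by
  unfold letter
  split_ifs with h
  · rw [Option.some_inj]
    exact ⟨fun e => e ▸ h.choose_spec, fun hz => sector_unique hd h.choose_spec hz⟩
  · exact ⟨fun e => by simp at e, fun hz => (h ⟨i, hz⟩).elim⟩

/-- The letter of `z` is `⋆` exactly when `z` is one of the `d` roots. -/
lemma letter_eq_none_iff {d : ℕ} (hd : 2 ≤ d) (α z : Circle) :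
    letter d α z = none ↔ powMap d z = α := by
  rw [← not_iff_not, ← Ne, ← Ne, ← exists_mem_sector_iff hd]
  unfold letter
  split_ifs with h
  · simp [h]
  · simp [h]

/-- The itinerary of `x`; digits are numbered from `1`, and the `n`-th digit (`n ≥ 1`) is the
letter of `h^(n-1)(x)`. -/
noncomputable def itinerary (d : ℕ) (α x : Circle) (n : ℕ) : Option (Fin d) :=
  letter d α ((powMap d)^[n - 1] x)

/-- Two itineraries agree in each digit in which neither of them is `⋆`. -/
def ItineraryCompatible (d : ℕ) (α x y : Circle) : Prop :=
  ∀ n : ℕ, 1 ≤ n → itinerary d α x n = itinerary d α y n ∨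
    itinerary d α x n = none ∨ itinerary d α y n = none

/-- The lamination of `α`: the equivalence relation generated by compatibility of itineraries. -/
def Lam (d : ℕ) (α : Circle) : Circle → Circle → Prop :=
  Relation.EqvGen (ItineraryCompatible d α)

/-! ## Gluing links, their pull-backs, encounter numbers -/

/-- A gluing link: a finite union of (at least one) disjoint closed arcs, possibly degenerate to
points, whose end points `a₀, b₀, a₁, b₁, …, aₘ, bₘ` are in counterclockwise order, the end of each
arc being equivalent to the beginning of the (cyclically) next one. -/
def IsGluingLink (d : ℕ) (α : Circle) (D : Set Circle) : Prop :=
  ∃ (m : ℕ) (a b : Fin (m + 1) → Circle),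
    (∀ i, Circle.angleDiff (a 0) (a i) ≤ Circle.angleDiff (a 0) (b i)) ∧
    (∀ i j, i < j → Circle.angleDiff (a 0) (b i) < Circle.angleDiff (a 0) (a j)) ∧
    (∀ i, Lam d α (b i) (a (i + 1))) ∧
    D = ⋃ i, closedArc (a i) (b i)

/-- A covering of the circle by gluing links `D x ∋ x`. -/
def IsGluingCover (d : ℕ) (α : Circle) (D : Circle → Set Circle) : Prop :=
  ∀ x, x ∈ D x ∧ IsGluingLink d α (D x)

/-- The `α`-components of `h^(-n)(E)`. A component `F` of `h^(-n)(E)` that does not contain `α` has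
`d` disjoint preimages under the inverse branches; a component that contains `α` has its whole
preimage `h⁻¹(F)` as a single component. -/
def alphaComponents (d : ℕ) (α : Circle) (E : Set Circle) : ℕ → Set (Set Circle)
  | 0 => {E}
  | n + 1 => {G | ∃ F ∈ alphaComponents d α E n,
      (α ∈ F ∧ G = powMap d ⁻¹' F) ∨ (α ∉ F ∧ ∃ i : Fin d, G = branchImage d α i F)}

/-- The `α`-component of `h^(-n)(E)` that contains `x`. -/
def alphaComp (d : ℕ) (α x : Circle) (n : ℕ) (E : Set Circle) : Set Circle :=
  ⋃₀ {G | G ∈ alphaComponents d α E n ∧ x ∈ G}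

/-- The pulled back covering: `D^(n)(x)` is the `α`-component of `h^(-n)(D(h^n(x)))` that
contains `x`. -/
def pullBack (d : ℕ) (α : Circle) (D : Circle → Set Circle) (n : ℕ) (x : Circle) : Set Circle :=
  alphaComp d α x n (D ((powMap d)^[n] x))

/-- The encounter number `N(x, n)`: the number of `1 ≤ i ≤ n` with `α ∈ D^(n-i)(h^i(x))`. -/
noncomputable def encounterNumber (d : ℕ) (α : Circle) (D : Circle → Set Circle)
    (x : Circle) (n : ℕ) : ℕ :=
  {i : ℕ | 1 ≤ i ∧ i ≤ n ∧ α ∈ pullBack d α D (n - i) ((powMap d)^[i] x)}.ncard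

/-- `L`-digit-fixing: for any two points of one `D^(n)(y)`, distinct positions among the first
`n + 1` at which their itineraries differ are more than `L` apart. -/
def DigitFixing (d : ℕ) (α : Circle) (L : ℕ) (D : Circle → Set Circle) : Prop :=
  ∀ (n : ℕ) (y x₁ x₂ : Circle), x₁ ∈ pullBack d α D n y → x₂ ∈ pullBack d α D n y →
    ∀ p q : ℕ, 1 ≤ p → p < q → q ≤ n + 1 →
      itinerary d α x₁ p ≠ itinerary d α x₂ p → itinerary d α x₁ q ≠ itinerary d α x₂ q →
      L < q - p

/-- The semi-CCE condition. The sequence `n₁ < n₂ < ⋯` of positive integers is indexed so that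
`n j` is its `(j + 1)`-st term. -/
def SemiCCE (d : ℕ) (α : Circle) : Prop :=
  ∃ L P M : ℕ, 0 < L ∧ 0 < P ∧
    ∀ D : Circle → Set Circle, IsGluingCover d α D → DigitFixing d α L D →
      ∀ x : Circle, ∃ n : ℕ → ℕ, StrictMono n ∧
        ∀ j, 1 ≤ n j ∧ n j ≤ P * (j + 1) ∧ encounterNumber d α D x (n j) ≤ M

/-! ## Strong recurrence -/

/-- `R` is `D`-rare: each window `[i, i + D]` contains at most three elements of `R`. -/
def IsRare (D : ℕ) (R : Set ℕ) : Prop :=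
  ∀ i : ℕ, (R ∩ Icc i (i + D)).ncard ≤ 3

/-- The interval `[a, b]` of digits of the itinerary of `α` is `R`-duplicating: it repeats the
initial word of that itinerary, up to digits in `R`. The initial position `a = 1`, where every
interval trivially repeats itself, is excluded. -/
def IsDuplicating (d : ℕ) (α : Circle) (R : Set ℕ) (a b : ℕ) : Prop :=
  1 < a ∧ a ≤ b ∧ ∀ m ∈ Icc a b, m ∉ R → itinerary d α α m = itinerary d α α (m - a + 1)

/-- The `i`-th digit of the word formed by the first `n` digits of the itinerary of `α` is
`(D, R)`-duplicating: it is covered by an `R`-duplicating interval of this word that covers the last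
digit or has length greater than `D`. -/
def IsDuplicatingDigit (d : ℕ) (α : Circle) (D : ℕ) (R : Set ℕ) (n i : ℕ) : Prop :=
  ∃ a b : ℕ, IsDuplicating d α R a b ∧ b ≤ n ∧ a ≤ i ∧ i ≤ b ∧ (b = n ∨ D < b - a + 1)

/-- Strong recurrence. -/
def StronglyRecurrent (d : ℕ) (α : Circle) : Prop :=
  ∀ D : ℕ, 0 < D → ∀ τ : ℝ, τ < 1 →
    ∃ n : ℕ, D < n ∧ ∃ R : Set ℕ, R ⊆ Icc 1 n ∧ IsRare D R ∧
      τ * n < ({i : ℕ | 1 ≤ i ∧ i ≤ n ∧ IsDuplicatingDigit d α D R n i}.ncard : ℝ)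

end UnicriticalLamination

namespace UnicriticalLamination

open Set Function

/-! ## Pull-backs and digits -/

/-! An encounter at time `i` puts `α` and `h^i(x)` in one pull-back, so the digits of `x` after
position `i` follow those of `α` up to sparse errors. When semi-CCE fails, some orbit has, at most
times, many encounters still in force. Cut time into blocks of length `T`: a block has only one
latest encounter covering it, but typically many covering it in total. Double counting
(`exists_dense_window`) therefore gives an encounter almost all of whose blocks are also covered by
later encounters. There the orbit of `x` follows `α` from two different starting times, so the
itinerary of `α` repeats earlier parts of itself on almost all blocks of a long prefix
(`exists_recurrent_prefix`).

For strong recurrence it remains to cut these repetitions into pieces that are long and hardly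
overlap, so that the errors of different pieces do not accumulate.

For the dimension, such a prefix is determined by few letters and one monotone sequence of shifts,
so there are few of them (`card_recurrent_words_mul_le`). A prefix in turn determines the base `d`
digits of `α` up to few choices: a letter differs from a digit only through the position of the
image relative to `α` (`digit_of_letter`, `card_codes_le`, `card_heads_le`). Hence the exceptional
angles are covered by `d`-adic intervals whose number at level `n` has arbitrarily small exponential
growth rate. -/

lemma exists_mem_alphaComponents {d : ℕ} (hd : 2 ≤ d) (α : Circle) (E : Set Circle) (n : ℕ)
    (x : Circle) (hx : (powMap d)^[n] x ∈ E) : ∃ G ∈ alphaComponents d α E n, x ∈ G := by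
  induction n generalizing x with
  | zero => exact ⟨E, rfl, hx⟩
  | succ n ih =>
    rw [iterate_succ_apply] at hx
    obtain ⟨F, hF, hxF⟩ := ih _ hx
    by_cases hα : α ∈ F
    · exact ⟨_, ⟨F, hF, Or.inl ⟨hα, rfl⟩⟩, hxF⟩
    · obtain ⟨i, hi⟩ := (exists_mem_sector_iff hd α x).2 fun h => hα (h ▸ hxF)
      exact ⟨_, ⟨F, hF, Or.inr ⟨hα, i, rfl⟩⟩, hi, hxF⟩

lemma mem_pullBack_self {d : ℕ} (hd : 2 ≤ d) {α : Circle} {D : Circle → Set Circle}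
    (hD : ∀ x, x ∈ D x) (n : ℕ) (x : Circle) : x ∈ pullBack d α D n x := by
  obtain ⟨G, hG, hx⟩ := exists_mem_alphaComponents hd α (D ((powMap d)^[n] x)) n x (hD _)
  exact ⟨G, ⟨hG, hx⟩, hx⟩

lemma itinerary_iterate (d : ℕ) (α x : Circle) (j : ℕ) {m : ℕ} (hm : 1 ≤ m) :
    itinerary d α ((powMap d)^[j] x) m = itinerary d α x (j + m) := by
  unfold itinerary
  rw [← iterate_add_apply]
  congr 2
  omega

/-- The orbit of `x` meets a pull-back containing `α` at time `i`, and this pull-back has depth at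
least `e - i`. -/
def Encounters (d : ℕ) (α : Circle) (D : Circle → Set Circle) (x : Circle) (i e : ℕ) : Prop :=
  1 ≤ i ∧ i ≤ e ∧ ∃ n, e ≤ n ∧ α ∈ pullBack d α D (n - i) ((powMap d)^[i] x)

lemma Encounters.mono {d : ℕ} {α : Circle} {D : Circle → Set Circle} {x : Circle} {i e e' : ℕ}
    (h : Encounters d α D x i e) (h1 : i ≤ e') (h2 : e' ≤ e) : Encounters d α D x i e' := by
  obtain ⟨hi, -, n, hn, hα⟩ := h
  exact ⟨hi, h1, n, h2.trans hn, hα⟩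

/-- After an encounter the digits of `x` follow those of `α`, up to sparse errors. -/
lemma Encounters.sparse {d : ℕ} (hd : 2 ≤ d) {α : Circle} {D : Circle → Set Circle} {x : Circle}
    {L i e : ℕ} (hD : IsGluingCover d α D) (hL : DigitFixing d α L D)
    (h : Encounters d α D x i e) {m m' : ℕ} (hm : 1 ≤ m) (hmm : m < m') (hm' : m' + i ≤ e + 1)
    (h1 : itinerary d α α m ≠ itinerary d α x (i + m))
    (h2 : itinerary d α α m' ≠ itinerary d α x (i + m')) : L < m' - m := by
  obtain ⟨hi, hie, n, hn, hα⟩ := h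
  -- A pull-back of depth `n - i` controls `n - i + 1` digits; this is the source of `e + 1` in the
  -- bound on `m' + i`.
  refine hL (n - i) _ α _ hα (mem_pullBack_self hd (fun x => (hD x).1) _ _) m m' hm hmm
    (by omega) ?_ ?_
  · rwa [itinerary_iterate d α x i hm]
  · rwa [itinerary_iterate d α x i (hm.trans hmm.le)]

open Classical in
/-- If the semi-CCE condition fails, then for some covering and some orbit the times with a bounded
number of encounters have small frequency. -/
lemma exists_many_encounters {d : ℕ} {α : Circle} (h : ¬ SemiCCE d α) {L P : ℕ} (hL : 0 < L)
    (hP : 0 < P) (M : ℕ) :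
    ∃ (D : Circle → Set Circle) (x : Circle) (J : ℕ), IsGluingCover d α D ∧ DigitFixing d α L D ∧
      ((Finset.Icc 1 (P * J)).filter fun n =>
        ((Finset.Icc 1 n).filter fun i => Encounters d α D x i n).card ≤ M).card < J := by
  by_contra hcon
  push Not at hcon
  refine h ⟨L, P, M, hL, hP, fun D hD hDL x => ?_⟩
  set p : ℕ → Prop := fun n =>
    1 ≤ n ∧ ((Finset.Icc 1 n).filter fun i => Encounters d α D x i n).card ≤ M with hp
  have hcount : ∀ J, J ≤ Nat.count p (P * J + 1) := fun J => by
    refine (hcon D x J hD hDL).trans ?_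
    rw [Nat.count_eq_card_filter_range]
    refine Finset.card_le_card fun n => ?_
    simp only [Finset.mem_filter, Finset.mem_Icc, Finset.mem_range, hp]
    rintro ⟨⟨h1, h2⟩, h3⟩
    exact ⟨by omega, h1, h3⟩
  have hinf : {n | p n}.Infinite := by
    intro hfin
    have h1 := hcount (hfin.toFinset.card + 1)
    rw [Nat.count_eq_card_filter_range] at h1
    have h2 : ((Finset.range (P * (hfin.toFinset.card + 1) + 1)).filter p).card ≤
        hfin.toFinset.card := Finset.card_le_card fun n hn => by
        simpa using (Finset.mem_filter.1 hn).2
    refine absurd (h1.trans ?_) (Nat.not_succ_le_self _)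
    convert h2
  refine ⟨Nat.nth p, Nat.nth_strictMono hinf, fun j => ?_⟩
  have hj := Nat.nth_mem_of_infinite hinf j
  refine ⟨hj.1, Nat.lt_succ_iff.1 (Nat.nth_lt_of_lt_count (hcount (j + 1))), le_trans ?_ hj.2⟩
  -- `Encounters` admits every depth at least `n - i`, so its count dominates the encounter number
  -- at `n`; the larger count is used because it is monotone in the end time.
  unfold encounterNumber
  rw [← Set.ncard_coe_finset]
  refine Set.ncard_le_ncard ?_ (Finset.finite_toSet _)
  rintro i ⟨h1, h2, h3⟩
  simp only [Finset.coe_filter, Finset.mem_Icc, mem_ofPred_eq]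
  exact ⟨⟨h1, h2⟩, h1, h2, _, le_rfl, h3⟩

/-! ## Double counting of blocks -/

open Classical in
/-- If most times `n` lie in more than `M` of the intervals `{e | Q i e}` starting at `i`, then one of
these intervals is almost exhausted by blocks of length `T` that lie in intervals starting later. -/
lemma exists_dense_window {Q : ℕ → ℕ → Prop} 
    (hmono : ∀ i e e', Q i e → i ≤ e' → e' ≤ e → Q i e') {T : ℕ} (hT : 0 < T) {ε : ℝ} (hε : 0 < ε)
    {M J : ℕ} (hM : 2 + 2 * T ≤ ε * (M + 1 - T))
    (hJ : ((Finset.Icc 1 (2 * T * J)).filter fun n =>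
      ((Finset.Icc 1 n).filter fun i => Q i n).card ≤ M).card < J) :
    ∃ i s₀ q : ℕ, i ≤ s₀ * T + 1 ∧ s₀ * T + 1 < i + T ∧ 0 < q ∧ Q i ((s₀ + q) * T) ∧
      (((Finset.range q).filter fun s =>
        ¬ ∃ j, i < j ∧ j ≤ (s₀ + s) * T + 1 ∧ Q j ((s₀ + s + 1) * T)).card : ℝ) + 1 ≤ ε * q := by
  -- Block `s` consists of the times in `(s * T, (s + 1) * T]`. `V i s` says that the interval
  -- starting at `i` covers the block, `U i s` that `i` is the latest such start.
  set V : ℕ → ℕ → Prop := fun i s => i ≤ s * T + 1 ∧ Q i ((s + 1) * T) with hV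
  set U : ℕ → ℕ → Prop := fun i s => V i s ∧ ¬ ∃ j, i < j ∧ V j s with hU
  set I := Finset.Icc 1 (2 * T * J) with hI
  set S := Finset.range (2 * J) with hS
  have hJ0 : 0 < J := by omega
  -- If this failed for all `2 * T * J` starts, summation would bound `ε * ∑ V` strictly by `∑ U + 2
  -- * T * J ≤ 2 * J + 2 * T * J`, whereas `∑ V ≥ J * (M + 1 - T)`; this contradicts `hM`. The
  -- summand `1` forces the chosen interval to cover some block, and later pays for the incomplete
  -- initial block.
  have key : ∃ i ∈ I, ((S.filter (U i)).card : ℝ) + 1 ≤ ε * (S.filter (V i)).card := by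
    by_contra hcon
    push Not at hcon
    have h1 : ∑ i ∈ I, ε * ((S.filter (V i)).card : ℝ) ≤
        ∑ i ∈ I, (((S.filter (U i)).card : ℝ) + 1) :=
      Finset.sum_le_sum fun i hi => (hcon i hi).le
    have h2 : ∑ i ∈ I, (S.filter (U i)).card ≤ 2 * J := by
      have := Finset.sum_card_bipartiteAbove_eq_sum_card_bipartiteBelow (s := I) (t := S) U
      unfold Finset.bipartiteAbove Finset.bipartiteBelow at this
      rw [this]
      refine (Finset.sum_le_card_nsmul S _ 1 fun s _ => ?_).trans (by simp [hS])
      refine Finset.card_le_one.2 fun i hi i' hi' => ?_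
      simp only [Finset.mem_filter] at hi hi'
      by_contra hne
      rcases lt_or_gt_of_ne hne with hlt | hlt
      · exact hi.2.2 ⟨i', hlt, hi'.2.1⟩
      · exact hi'.2.2 ⟨i, hlt, hi.2.1⟩
    have h3 : J * (M + 1) ≤ ∑ i ∈ I, (S.filter (V i)).card + J * T := by
      have := Finset.sum_card_bipartiteAbove_eq_sum_card_bipartiteBelow (s := I) (t := S) V
      unfold Finset.bipartiteAbove Finset.bipartiteBelow at this
      rw [this]
      set B := S.filter fun s => ((Finset.Icc 1 ((s + 1) * T)).filter
        fun i => Q i ((s + 1) * T)).card ≤ M with hB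
      set G := S.filter fun s => ¬ ((Finset.Icc 1 ((s + 1) * T)).filter
        fun i => Q i ((s + 1) * T)).card ≤ M with hG
      have hcard : B.card + G.card = 2 * J := by
        rw [hB, hG, Finset.card_filter_add_card_filter_not]; simp [hS]
      have hBJ : B.card < J := by
        refine lt_of_le_of_lt (Finset.card_le_card_of_injOn (fun s => (s + 1) * T) ?_ ?_) hJ
        · intro s hs
          rw [hB, Finset.mem_coe, Finset.mem_filter, hS, Finset.mem_range] at hs
          rw [Finset.mem_coe, Finset.mem_filter, Finset.mem_Icc]
          refine ⟨⟨Nat.mul_pos (by omega) hT, ?_⟩, hs.2⟩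
          calc (s + 1) * T ≤ (2 * J) * T := Nat.mul_le_mul_right _ (by omega)
            _ = _ := by ring
        · intro s _ s' _ hss
          have := Nat.eq_of_mul_eq_mul_right hT hss
          omega
      -- Of the more than `M` intervals present at the end of the block, at most `T` start inside
      -- it.
      have hGV : ∀ s ∈ G, M + 1 ≤ (I.filter fun i => V i s).card + T := by
        intro s hs
        simp only [hG, hS, Finset.mem_filter, Finset.mem_range, not_le] at hs
        have hsub : (Finset.Icc 1 ((s + 1) * T)).filter (fun i => Q i ((s + 1) * T)) ⊆
            (I.filter fun i => V i s) ∪ Finset.Ioc (s * T) ((s + 1) * T) := by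
          intro i
          simp only [Finset.mem_filter, Finset.mem_Icc, Finset.mem_union, Finset.mem_Ioc, hI, hV]
          rintro ⟨⟨h1, h2⟩, h3⟩
          have : (s + 1) * T ≤ 2 * T * J :=
            calc (s + 1) * T ≤ (2 * J) * T := Nat.mul_le_mul_right _ (by omega)
              _ = _ := by ring
          by_cases h4 : i ≤ s * T
          · exact Or.inl ⟨⟨h1, h2.trans this⟩, by omega, h3⟩
          · exact Or.inr ⟨by omega, h2⟩
        have h5 := (Finset.card_le_card hsub).trans (Finset.card_union_le _ _)
        have h6 : (s + 1) * T - s * T = T := by rw [add_mul, one_mul, Nat.add_sub_cancel_left]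
        rw [Nat.card_Ioc, h6] at h5
        omega
      obtain ⟨G', hG', hG'c⟩ := Finset.exists_subset_card_eq (show J ≤ G.card by omega)
      have h7 := Finset.card_nsmul_le_sum G' _ _ fun s hs => hGV s (hG' hs)
      rw [Finset.sum_add_distrib, Finset.sum_const, hG'c, smul_eq_mul, smul_eq_mul] at h7
      have h8 : ∑ s ∈ G', (I.filter fun i => V i s).card ≤ ∑ s ∈ S, (I.filter fun i => V i s).card :=
        Finset.sum_le_sum_of_subset (hG'.trans (Finset.filter_subset _ _))
      exact h7.trans (Nat.add_le_add_right h8 _)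
    have h2' : (∑ i ∈ I, ((S.filter (U i)).card : ℝ)) ≤ 2 * J := by exact_mod_cast h2
    have h3' : (J : ℝ) * (M + 1) ≤ ∑ i ∈ I, ((S.filter (V i)).card : ℝ) + J * T := by
      exact_mod_cast h3
    have hstrict : ∑ i ∈ I, ε * ((S.filter (V i)).card : ℝ) <
        ∑ i ∈ I, (((S.filter (U i)).card : ℝ) + 1) :=
      Finset.sum_lt_sum_of_nonempty
        ⟨1, Finset.mem_Icc.2 ⟨le_rfl, Nat.mul_pos (by omega) hJ0⟩⟩ hcon
    rw [← Finset.mul_sum, Finset.sum_add_distrib, Finset.sum_const, nsmul_eq_mul, mul_one, hI,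
      Nat.card_Icc, Nat.add_sub_cancel, ← hI] at hstrict
    push_cast at hstrict
    have hJr : (0 : ℝ) < J := by exact_mod_cast hJ0
    have h8 := mul_le_mul_of_nonneg_left h3' hε.le
    have h9 := mul_le_mul_of_nonneg_left hM hJr.le
    nlinarith
  obtain ⟨i, hi, hUV⟩ := key
  simp only [hI, Finset.mem_Icc] at hi
  have hne : (S.filter (V i)).Nonempty := by
    rw [Finset.nonempty_iff_ne_empty]
    intro he
    rw [he] at hUV
    simp only [Finset.card_empty, Nat.cast_zero, mul_zero] at hUV
    have : (0 : ℝ) ≤ (S.filter (U i)).card := Nat.cast_nonneg _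
    linarith
  set s₀ := (S.filter (V i)).min' hne with hs₀
  set s₁ := (S.filter (V i)).max' hne with hs₁
  have m0 := (S.filter (V i)).min'_mem hne
  have m1 := (S.filter (V i)).max'_mem hne
  rw [← hs₀] at m0
  rw [← hs₁] at m1
  simp only [hS, hV, Finset.mem_filter, Finset.mem_range] at m0 m1
  have h01 : s₀ ≤ s₁ := Finset.min'_le_max' _ hne
  have hmem : ∀ s, s₀ ≤ s → s ≤ s₁ → s ∈ S.filter (V i) := by
    intro s h0 h1
    have a1 : s₀ * T ≤ s * T := Nat.mul_le_mul_right _ h0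
    have a2 : (s + 1) * T ≤ (s₁ + 1) * T := Nat.mul_le_mul_right _ (by omega)
    simp only [hS, hV, Finset.mem_filter, Finset.mem_range]
    refine ⟨by omega, by omega, hmono _ _ _ m1.2.2 ?_ a2⟩
    rw [add_mul]
    omega
  refine ⟨i, s₀, s₁ - s₀ + 1, m0.2.1, ?_, by omega, ?_, ?_⟩
  -- If the start were earlier, the preceding block would be covered too, against minimality of
  -- `s₀`.
  · by_contra hlt
    obtain ⟨t, ht⟩ : ∃ t, s₀ = t + 1 := ⟨s₀ - 1, by
      rcases Nat.eq_zero_or_pos s₀ with h | h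
      · rw [h] at hlt; omega
      · omega⟩
    have hmt : t ∈ S.filter (V i) := by
      simp only [hS, hV, Finset.mem_filter, Finset.mem_range]
      rw [ht, add_mul] at hlt
      refine ⟨by omega, by omega, hmono _ _ _ m0.2.2 ?_ ?_⟩
      · rw [add_mul]; omega
      · exact Nat.mul_le_mul_right _ (by omega)
    have := (S.filter (V i)).min'_le t hmt
    omega
  · rw [show s₀ + (s₁ - s₀ + 1) = s₁ + 1 by omega]; exact m1.2.2
  · have c1 : (S.filter (V i)).card ≤ s₁ - s₀ + 1 := by
      have : (S.filter (V i)) ⊆ Finset.Icc s₀ s₁ := fun s hs =>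
        Finset.mem_Icc.2 ⟨Finset.min'_le _ _ hs, Finset.le_max' _ _ hs⟩
      have := Finset.card_le_card this
      rw [Nat.card_Icc] at this
      omega
    have c2 : ((Finset.range (s₁ - s₀ + 1)).filter fun s =>
        ¬ ∃ j, i < j ∧ j ≤ (s₀ + s) * T + 1 ∧ Q j ((s₀ + s + 1) * T)).card ≤
        (S.filter (U i)).card := by
      refine Finset.card_le_card_of_injOn (fun s => s₀ + s) ?_ fun a _ b _ h => by simpa using h
      intro s hs
      simp only [Finset.coe_filter, Finset.mem_range, mem_ofPred_eq] at hs
      have := hmem (s₀ + s) (by omega) (by omega)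
      rw [Finset.mem_filter] at this
      rw [Finset.mem_coe, Finset.mem_filter]
      exact ⟨this.1, this.2, hs.2⟩
    calc _ ≤ ((S.filter (U i)).card : ℝ) + 1 := by gcongr
      _ ≤ ε * (S.filter (V i)).card := hUV
      _ ≤ _ := by gcongr

/-! ## Almost self-similar prefixes -/

open Classical in
/-- If the semi-CCE condition fails, then the itinerary `w` of `α` has a prefix made of a short
initial word and of `q` blocks of length `T`, most of which repeat earlier digits of `w` up to sparse
errors. The shifts are given by a monotone function `c`; the errors are measured by comparing both
copies with a third word `u`. -/
lemma exists_recurrent_prefix {d : ℕ} (hd : 2 ≤ d) {α : Circle} (h : ¬ SemiCCE d α) {T : ℕ}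
    (hT : 0 < T) {ε : ℝ} (hε : 0 < ε) :
    ∃ (q r : ℕ) (c : ℕ → ℕ) (C : Finset ℕ) (u : ℕ → Option (Fin d)),
      0 < q ∧ r < T ∧ C ⊆ Finset.range q ∧ Monotone c ∧ (∀ s, c s ≤ r + (s + 1) * T) ∧
      (((Finset.range q).filter fun s => s ∉ C).card : ℝ) + 1 ≤ ε * q ∧
      (∀ m m', 1 ≤ m → m < m' → m' ≤ r + q * T →
        itinerary d α α m ≠ u m → itinerary d α α m' ≠ u m' → T < m' - m) ∧
      ∀ s ∈ C, 1 ≤ c s ∧ c s ≤ r + s * T ∧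
        ∀ m m', c s < m → m < m' → m' ≤ r + (s + 1) * T →
          itinerary d α α (m - c s) ≠ u m → itinerary d α α (m' - c s) ≠ u m' → T < m' - m := by
  obtain ⟨M, hM⟩ := exists_nat_ge ((2 + 2 * T) / ε - 1 + T : ℝ)
  have hM' : 2 + 2 * (T : ℝ) ≤ ε * (M + 1 - T) := by
    rw [← div_le_iff₀' hε]; linarith
  obtain ⟨D, x, J, hD, hL, hJ⟩ := exists_many_encounters h hT (P := 2 * T) (by omega) M
  obtain ⟨i, s₀, q, h1, h2, hq, hQ, hcard⟩ := exists_dense_window (Q := Encounters d α D x)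
    (fun i e e' h => h.mono) hT hε hM' hJ
  obtain ⟨r, hr⟩ : ∃ r, s₀ * T + 1 = i + r := ⟨s₀ * T + 1 - i, by omega⟩
  -- Admissible shifts: later encounters lasting to the end of block `s`. The second alternative is
  -- a default that keeps `K s` nonempty and decreasing in `s`, so that its minimum `c` is monotone;
  -- for a block in `C` the minimum is a true encounter.
  set K : ℕ → Set ℕ := fun s => {k | 1 ≤ k ∧
    (Encounters d α D x (i + k) ((s₀ + s + 1) * T) ∨ (s₀ + s + 1) * T < i + k)} with hK
  have hblock : ∀ s, (s₀ + s) * T + 1 = i + r + s * T := fun s => by rw [add_mul]; omega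
  have hblock' : ∀ s, (s₀ + s + 1) * T + 1 = i + r + (s + 1) * T := fun s => by
    rw [add_assoc]; exact hblock _
  have hKmem : ∀ s, r + (s + 1) * T ∈ K s := fun s => by
    have := hblock' s
    have : 0 < (s + 1) * T := Nat.mul_pos (by omega) hT
    exact ⟨by omega, Or.inr (by omega)⟩
  obtain ⟨c, hcK, hcle⟩ : ∃ c : ℕ → ℕ, (∀ s, c s ∈ K s) ∧ ∀ s, ∀ k ∈ K s, c s ≤ k :=
    ⟨fun s => sInf (K s), fun s => Nat.sInf_mem ⟨_, hKmem s⟩, fun s k hk => Nat.sInf_le hk⟩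
  set C := (Finset.range q).filter fun s =>
    ∃ j, i < j ∧ j ≤ (s₀ + s) * T + 1 ∧ Encounters d α D x j ((s₀ + s + 1) * T) with hC
  refine ⟨q, r, c, C, fun m => itinerary d α x (i + m), hq, by omega,
    Finset.filter_subset _ _, ?_, ?_, ?_,
    ?_, ?_⟩
  · intro s s' hss
    obtain ⟨k1, k2⟩ := hcK s'
    have hT' : (s₀ + s + 1) * T ≤ (s₀ + s' + 1) * T := Nat.mul_le_mul_right _ (by omega)
    refine hcle s _ ⟨k1, ?_⟩
    rcases k2 with k2 | k2
    · rcases le_or_gt (i + c s') ((s₀ + s + 1) * T) with k3 | k3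
      · exact Or.inl (k2.mono k3 hT')
      · exact Or.inr k3
    · exact Or.inr (by omega)
  · exact fun s => hcle s _ (hKmem s)
  · refine le_trans (add_le_add_left (Nat.cast_le.2 (Finset.card_le_card ?_)) 1) hcard
    intro s
    simp only [hC, Finset.mem_filter, Finset.mem_range]
    exact fun hs => ⟨hs.1, fun hj => hs.2 ⟨hs.1, hj⟩⟩
  · intro m m' hm hmm hm' e1 e2
    have := hblock q
    exact hQ.sparse hd hD hL hm hmm (by omega) e1 e2
  · intro s hs
    simp only [hC, Finset.mem_filter, Finset.mem_range] at hs
    obtain ⟨hsq, j, hij, hj, hjQ⟩ := hs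
    have b1 := hblock s
    have b2 := hblock' s
    have hle : c s ≤ j - i := hcle s _ ⟨by omega, Or.inl (by
      rwa [show i + (j - i) = j by omega])⟩
    obtain ⟨k1, k2⟩ := hcK s
    refine ⟨k1, by omega, ?_⟩
    have b3 : (s + 1) * T = s * T + T := by rw [add_mul, one_mul]
    have k3 : Encounters d α D x (i + c s) ((s₀ + s + 1) * T) :=
      k2.resolve_right (by omega)
    intro m m' hm hmm hm' e1 e2
    have := k3.sparse hd hD hL (m := m - c s) (m' := m' - c s) (by omega) (by omega)
      (by omega) (by rwa [show i + c s + (m - c s) = i + m by omega])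
      (by rwa [show i + c s + (m' - c s) = i + m' by omega])
    omega

/-! ## Strong recurrence -/

/-- The repetitions given by `exists_recurrent_prefix` may overlap heavily, and each brings its own
errors. Each one is cut where the next larger shift starts, and pieces of length at most `D` are
discarded. Then a window of length `D` meets errors of at most two pieces, one from each, besides at
most one error of the reference word `u`. -/
theorem stronglyRecurrent_of_not_semiCCE {d : ℕ} (hd : 2 ≤ d) {α : Circle}
    (h : ¬ SemiCCE d α) : StronglyRecurrent d α := by
  classical
  intro D hD τ hτ
  set τ' := max τ 0 with hτ'
  have hτ1 : τ' < 1 := max_lt hτ one_pos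
  have hτ0 : 0 ≤ τ' := le_max_right _ _
  -- Half of the admissible loss `1 - τ'` goes to the uncovered blocks, half to the at most `q`
  -- discarded pieces of length at most `D`.
  obtain ⟨T, hT⟩ := exists_nat_ge (2 * D / (1 - τ') : ℝ)
  have hDT' : 2 * (D : ℝ) ≤ T * (1 - τ') := (div_le_iff₀ (by linarith)).1 hT
  have hDr : (0 : ℝ) < D := by exact_mod_cast hD
  have hDT : D < T := by
    have : (D : ℝ) < T := by
      have : (0 : ℝ) ≤ T := Nat.cast_nonneg _
      nlinarith
    exact_mod_cast this
  obtain ⟨q, r, c, C, u, hq, hr, hCq, hc, -, hunc, hE, hF⟩ :=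
    exists_recurrent_prefix hd h (T := T) (by omega) (ε := (1 - τ') / 2) (by linarith)
  set n := r + q * T with hn
  have hqT : T ≤ q * T := Nat.le_mul_of_pos_left T hq
  have hend : ∀ s ∈ C, r + (s + 1) * T ≤ n := fun s hs => by
    have := Nat.mul_le_mul_right T (Nat.succ_le_of_lt (Finset.mem_range.1 (hCq hs)))
    rw [Nat.succ_eq_add_one] at this
    omega
  set w := itinerary d α α with hw
  set b : ℕ → ℕ := fun s =>
    (insert (r + (s + 1) * T) ((C.filter fun s' => c s < c s').image c)).min'
      (Finset.insert_nonempty _ _) with hb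
  have hle_b : ∀ s m, m ≤ b s ↔ m ≤ r + (s + 1) * T ∧ ∀ s' ∈ C, c s < c s' → m ≤ c s' := by
    intro s m
    simp only [hb, Finset.le_min'_iff, Finset.mem_insert, Finset.mem_image, Finset.mem_filter]
    constructor
    · exact fun H => ⟨H _ (Or.inl rfl), fun s' h1 h2 => H _ (Or.inr ⟨s', ⟨h1, h2⟩, rfl⟩)⟩
    · rintro ⟨H1, H2⟩ y (rfl | ⟨s', ⟨h1, h2⟩, rfl⟩)
      exacts [H1, H2 s' h1 h2]
  -- Of the blocks sharing a shift only the last is kept, since its repetition reaches furthest; `c`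
  -- becomes injective.
  set C' := C.filter fun s => ∀ s' ∈ C, s < s' → c s < c s' with hC'
  have hCC : ∀ s ∈ C', s ∈ C := fun s hs => (Finset.mem_filter.1 hs).1
  have hinj : ∀ s ∈ C', ∀ s' ∈ C', c s = c s' → s = s' := by
    intro s hs s' hs' he
    rcases lt_trichotomy s s' with hlt | heq | hlt
    · exact absurd ((Finset.mem_filter.1 hs).2 s' (hCC _ hs') hlt) (by omega)
    · exact heq
    · exact absurd ((Finset.mem_filter.1 hs').2 s (hCC _ hs) hlt) (by omega)
  set G := C'.filter fun s => D < b s - c s with hG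
  have hGC : ∀ s ∈ G, s ∈ C' := fun s hs => (Finset.mem_filter.1 hs).1
  set R₀ : Set ℕ := {m | 1 ≤ m ∧ m ≤ n ∧ w m ≠ u m} with hR₀
  set R₁ : Set ℕ := {m | ∃ s ∈ G, c s < m ∧ m ≤ b s ∧ w (m - c s) ≠ u m} with hR₁
  have hbn : ∀ s ∈ C, b s ≤ n := fun s hs => ((hle_b s _).1 le_rfl).1.trans (hend s hs)
  refine ⟨n, by omega, R₀ ∪ R₁, ?_, ?_, ?_⟩
  · rintro m (⟨h1, h2, -⟩ | ⟨s, hs, h1, h2, -⟩)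
    · exact ⟨h1, h2⟩
    · exact ⟨by omega, h2.trans (hbn s (hCC _ (hGC _ hs)))⟩
  · intro i
    have hR₀c : (R₀ ∩ Icc i (i + D)).ncard ≤ 1 := by
      rw [Set.ncard_le_one ((finite_Icc _ _).inter_of_right _)]
      rintro m ⟨⟨m1, m2, m3⟩, m4, m5⟩ m' ⟨⟨m1', m2', m3'⟩, m4', m5'⟩
      by_contra hne
      rcases lt_or_gt_of_ne hne with hlt | hlt
      · have := hE m m' m1 hlt m2' m3 m3'; omega
      · have := hE m' m m1' hlt m2 m3' m3; omega
    -- Errors of one piece are more than `T > D` apart, so three errors in the window would lie in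
    -- three pieces with increasing shifts. The middle piece would be squeezed between the outer two
    -- errors and have length at most `D`, which `G` excludes.
    have hR₁c : (R₁ ∩ Icc i (i + D)).ncard ≤ 2 := by
      rcases (R₁ ∩ Icc i (i + D)).eq_empty_or_nonempty with he | hne
      · simp [he]
      have hfin : (R₁ ∩ Icc i (i + D)).Finite := (finite_Icc _ _).inter_of_right _
      obtain ⟨m₁, hm₁, hmin⟩ := Set.exists_min_image _ id hfin hne
      obtain ⟨m₃, hm₃, hmax⟩ := Set.exists_max_image _ id hfin hne
      refine (Set.ncard_le_ncard (t := {m₁, m₃}) ?_ (by simp)).trans ((Set.ncard_insert_le _ _).trans (by simp))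
      intro m₂ hm₂
      by_contra hcon
      simp only [mem_insert_iff, mem_singleton_iff, not_or] at hcon
      have h12 : m₁ < m₂ := lt_of_le_of_ne (hmin _ hm₂) (Ne.symm hcon.1)
      have h23 : m₂ < m₃ := lt_of_le_of_ne (hmax _ hm₂) hcon.2
      have step : ∀ m m' s s', m < m' → m' ≤ m + D → s ∈ G → s' ∈ G → c s < m → m ≤ b s →
          w (m - c s) ≠ u m → c s' < m' → m' ≤ b s' → w (m' - c s') ≠ u m' → c s < c s' := by
        intro m m' s s' hmm hmD hs hs' a1 a2 a3 b1 b2 b3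
        by_contra hlt
        rcases eq_or_lt_of_le (not_lt.1 hlt) with heq | hlt
        · obtain rfl := hinj _ (hGC _ hs') _ (hGC _ hs) heq
          have := (hF _ (hCC _ (hGC _ hs))).2.2 m m' a1 hmm ((hle_b _ _).1 b2).1 a3 b3
          omega
        · have := ((hle_b _ _).1 b2).2 s (hCC _ (hGC _ hs)) hlt
          omega
      obtain ⟨⟨s₁, g1, a1, a2, a3⟩, w1⟩ := hm₁
      obtain ⟨⟨s₂, g2, b1, b2, b3⟩, w2⟩ := hm₂
      obtain ⟨⟨s₃, g3, c1, c2, c3⟩, w3⟩ := hm₃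
      rw [mem_Icc] at w1 w2 w3
      have l12 := step m₁ m₂ s₁ s₂ h12 (by omega) g1 g2 a1 a2 a3 b1 b2 b3
      have l23 := step m₂ m₃ s₂ s₃ h23 (by omega) g2 g3 b1 b2 b3 c1 c2 c3
      have e1 := ((hle_b _ _).1 a2).2 s₂ (hCC _ (hGC _ g2)) l12
      have e2 := ((hle_b s₂ _).1 le_rfl).2 s₃ (hCC _ (hGC _ g3)) l23
      have e3 := (Finset.mem_filter.1 g2).2
      omega
    rw [union_inter_distrib_right]
    exact (Set.ncard_union_le _ _).trans (by omega)
  · set Y := (Finset.Icc 1 n).filter fun m => ∃ s ∈ G, c s < m ∧ m ≤ b s with hY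
    have hYle : Y.card ≤ {i : ℕ | 1 ≤ i ∧ i ≤ n ∧
        IsDuplicatingDigit d α D (R₀ ∪ R₁) n i}.ncard := by
      rw [← Set.ncard_coe_finset]
      refine Set.ncard_le_ncard ?_ ((finite_Icc 1 n).subset fun i hi => ⟨hi.1, hi.2.1⟩)
      intro m hm
      rw [Finset.mem_coe, hY, Finset.mem_filter, Finset.mem_Icc] at hm
      obtain ⟨⟨m1, m2⟩, s, hs, m3, m4⟩ := hm
      have hsC := hCC _ (hGC _ hs)
      have hc1 := (hF s hsC).1
      have hlen := (Finset.mem_filter.1 hs).2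
      refine ⟨m1, m2, c s + 1, b s, ⟨by omega, by omega, ?_⟩, hbn s hsC, by omega, m4,
        Or.inr (by omega)⟩
      intro k hk hkR
      rw [mem_Icc] at hk
      have hkn := hbn s hsC
      have k1 : w k = u k := by
        by_contra hne
        exact hkR (Or.inl ⟨by omega, by omega, hne⟩)
      have k2 : w (k - c s) = u k := by
        by_contra hne
        exact hkR (Or.inr ⟨s, hs, by omega, by omega, hne⟩)
      rw [show k - (c s + 1) + 1 = k - c s by omega]
      exact k1.trans k2.symm
    set B := (Finset.range q).filter fun s => s ∉ C with hB
    have hcover : Finset.Icc 1 n ⊆ Finset.Icc 1 r ∪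
        B.biUnion (fun s => Finset.Ioc (r + s * T) (r + (s + 1) * T)) ∪
        (C'.filter fun s => ¬ D < b s - c s).biUnion (fun s => Finset.Ioc (c s) (b s)) ∪ Y := by
      intro m hm
      rw [Finset.mem_Icc] at hm
      simp only [Finset.mem_union, Finset.mem_biUnion, Finset.mem_Icc, Finset.mem_Ioc]
      by_cases hmr : m ≤ r
      · exact Or.inl (Or.inl (Or.inl ⟨hm.1, hmr⟩))
      set s := (m - r - 1) / T with hs
      have s1 : s * T ≤ m - r - 1 := Nat.div_mul_le_self _ _
      have s2 : m - r - 1 < (s + 1) * T := by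
        rw [mul_comm]; exact Nat.lt_mul_div_succ _ (by omega)
      have hsq : s < q := by
        by_contra hge
        have := Nat.mul_le_mul_right T (not_lt.1 hge)
        omega
      by_cases hsC : s ∈ C
      · have hCm : ((C.filter fun s' => c s' < m ∧ m ≤ r + (s' + 1) * T)).Nonempty :=
          ⟨s, Finset.mem_filter.2 ⟨hsC, by have := (hF s hsC).2.1; omega, by omega⟩⟩
        -- Take the last block whose uncut repetition contains `m`. All later shifts are at least
        -- `m`, so `t` survives in `C'` and the cut does not remove `m`.
        obtain ⟨t, ht, htmax⟩ := Finset.exists_max_image _ id hCm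
        rw [Finset.mem_filter] at ht
        have hlater : ∀ s' ∈ C, t < s' → m ≤ c s' := by
          intro s' hs' hts
          by_contra hlt
          have h1 : (t + 1) * T ≤ (s' + 1) * T := Nat.mul_le_mul_right _ (by omega)
          have := htmax s' (Finset.mem_filter.2 ⟨hs', by omega, by omega⟩)
          simp only [id] at this
          omega
        have htC' : t ∈ C' := Finset.mem_filter.2 ⟨ht.1, fun s' hs' hts =>
          ht.2.1.trans_le (hlater s' hs' hts)⟩
        have hmb : m ≤ b t := (hle_b _ _).2 ⟨ht.2.2, fun s' hs' hlt => hlater s' hs' (by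
          by_contra hge
          have := hc (not_lt.1 hge)
          omega)⟩
        by_cases hg : D < b t - c t
        · exact Or.inr (Finset.mem_filter.2 ⟨Finset.mem_Icc.2 hm, t,
            Finset.mem_filter.2 ⟨htC', hg⟩, ht.2.1, hmb⟩)
        · exact Or.inl (Or.inr ⟨t, Finset.mem_filter.2 ⟨htC', hg⟩, ht.2.1, hmb⟩)
      · exact Or.inl (Or.inl (Or.inr ⟨s, Finset.mem_filter.2 ⟨Finset.mem_range.2 hsq, hsC⟩,
          by omega, by omega⟩))
    have hcard : n ≤ r + B.card * T + q * D + Y.card := by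
      have h0 := Finset.card_le_card hcover
      have h1 := Finset.card_union_le (Finset.Icc 1 r ∪
        B.biUnion (fun s => Finset.Ioc (r + s * T) (r + (s + 1) * T)) ∪
        (C'.filter fun s => ¬ D < b s - c s).biUnion (fun s => Finset.Ioc (c s) (b s))) Y
      have h2 := Finset.card_union_le (Finset.Icc 1 r ∪
        B.biUnion (fun s => Finset.Ioc (r + s * T) (r + (s + 1) * T)))
        ((C'.filter fun s => ¬ D < b s - c s).biUnion (fun s => Finset.Ioc (c s) (b s)))
      have h3 := Finset.card_union_le (Finset.Icc 1 r)
        (B.biUnion (fun s => Finset.Ioc (r + s * T) (r + (s + 1) * T)))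
      have h4 : (B.biUnion (fun s => Finset.Ioc (r + s * T) (r + (s + 1) * T))).card ≤
          B.card * T := Finset.card_biUnion_le_card_mul _ _ _ fun s _ => by
        rw [Nat.card_Ioc, add_mul]; omega
      have h5 : ((C'.filter fun s => ¬ D < b s - c s).biUnion
          (fun s => Finset.Ioc (c s) (b s))).card ≤ (C'.filter fun s => ¬ D < b s - c s).card * D :=
        Finset.card_biUnion_le_card_mul _ _ _ fun s hs => by
          rw [Nat.card_Ioc]; exact not_lt.1 (Finset.mem_filter.1 hs).2
      have h6 : (C'.filter fun s => ¬ D < b s - c s).card ≤ q := by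
        refine (Finset.card_le_card ?_).trans (Finset.card_range q).le
        exact (Finset.filter_subset _ _).trans ((Finset.filter_subset _ _).trans hCq)
      have h7 := Nat.mul_le_mul_right D h6
      rw [Nat.card_Icc] at h0 h3
      omega
    refine lt_of_lt_of_le ?_ (Nat.cast_le.2 hYle)
    have hcard' : (n : ℝ) ≤ r + B.card * T + q * D + Y.card := by exact_mod_cast hcard
    have hrT : (r : ℝ) < T := by exact_mod_cast hr
    have hnr : (n : ℝ) = r + q * T := by rw [hn]; push_cast; ring
    have hTr : (0 : ℝ) < T := hDr.trans (by exact_mod_cast hDT)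
    have hqr : (0 : ℝ) < q := by exact_mod_cast hq
    -- The `+ 1` in `hunc` absorbs the `r < T` initial letters.
    have f1 := mul_le_mul_of_nonneg_right hunc hTr.le
    have f2 := mul_le_mul_of_nonneg_left hDT' hqr.le
    have f3 : τ * n ≤ τ' * n := mul_le_mul_of_nonneg_right (le_max_left _ _) (Nat.cast_nonneg _)
    have f4 : (1 - τ') * (q * T) ≤ (1 - τ') * n := by
      refine mul_le_mul_of_nonneg_left ?_ (by linarith)
      rw [hnr]
      have : (0 : ℝ) ≤ r := Nat.cast_nonneg _
      linarith
    nlinarith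

/-! ## Counting almost self-similar words -/

/-- The word `w` consists of `r` letters followed by `q` blocks of length `T`, most of which repeat
earlier letters up to sparse errors, with monotone shifts. -/
def IsBlockRecurrent {β : Type*} (T : ℕ) (ε : ℝ) (q r : ℕ) (w : ℕ → β) : Prop :=
  ∃ (c : ℕ → ℕ) (C : Set ℕ) (u : ℕ → β), Monotone c ∧ (∀ s, c s ≤ r + (s + 1) * T) ∧
    (({s | s < q ∧ s ∉ C}.ncard : ℝ) + 1 ≤ ε * q) ∧
    (∀ m m', 1 ≤ m → m < m' → m' ≤ r + q * T → w m ≠ u m → w m' ≠ u m' → T < m' - m) ∧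
    ∀ s ∈ C, 1 ≤ c s ∧ c s ≤ r + s * T ∧
      ∀ m m', r + s * T < m → m < m' → m' ≤ r + (s + 1) * T →
        w (m - c s) ≠ u m → w (m' - c s) ≠ u m' → T < m' - m

-- Counting needs the errors of a shifted copy only inside the block itself, where `c s ≤ r + s * T
-- < m` holds automatically.
open Classical in
lemma exists_isBlockRecurrent {d : ℕ} (hd : 2 ≤ d) {α : Circle} (h : ¬ SemiCCE d α) {T : ℕ}
    (hT : 0 < T) {ε : ℝ} (hε : 0 < ε) :
    ∃ q r : ℕ, 0 < q ∧ r < T ∧ IsBlockRecurrent T ε q r (itinerary d α α) := by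
  obtain ⟨q, r, c, C, u, hq, hr, -, hc, hcle, hunc, hE, hF⟩ := exists_recurrent_prefix hd h hT hε
  refine ⟨q, r, hq, hr, c, C, u, hc, hcle, ?_, hE, fun s hs => ?_⟩
  · convert hunc
    rw [← Set.ncard_coe_finset]
    congr 1
    ext s
    simp
  · obtain ⟨h1, h2, h3⟩ := hF s hs
    exact ⟨h1, h2, fun m m' hm => h3 m m' (by omega)⟩

-- Chernoff's argument: give each function the weight `x` to the power of its number of letters. As
-- `x ≤ 1`, a sparse function weighs at least `x ^ ρ`, and the total weight factors over the
-- positions.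
open Classical in
lemma card_sparse_functions_mul_le (β : Type*) [Fintype β] (n : ℕ) {x ρ : ℝ} (hx : 0 < x)
    (hx1 : x ≤ 1) :
    ((Finset.univ.filter fun p : Fin n → Option β =>
      ((Finset.univ.filter fun k => p k ≠ none).card : ℝ) ≤ ρ).card : ℝ) * x ^ ρ ≤
      (1 + Fintype.card β * x) ^ n := by
  set S := Finset.univ.filter fun p : Fin n → Option β =>
      ((Finset.univ.filter fun k => p k ≠ none).card : ℝ) ≤ ρ with hS
  set f : Option β → ℝ := fun o => if o ≠ none then x else 1 with hf
  have hf0 : ∀ o, 0 ≤ f o := fun o => by simp only [hf]; split_ifs <;> positivity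
  have h1 : ∀ p : Fin n → Option β, ∏ k, f (p k) =
      x ^ (Finset.univ.filter fun k => p k ≠ none).card := fun p => by
    simp only [hf]
    rw [Finset.prod_ite]
    simp
  calc _ = ∑ p ∈ S, x ^ ρ := by rw [Finset.sum_const, nsmul_eq_mul]
    _ ≤ ∑ p ∈ S, ∏ k, f (p k) := Finset.sum_le_sum fun p hp => by
        rw [h1, ← Real.rpow_natCast]
        exact Real.rpow_le_rpow_of_exponent_ge hx hx1 (Finset.mem_filter.1 hp).2
    _ ≤ ∑ p : Fin n → Option β, ∏ k, f (p k) :=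
        Finset.sum_le_sum_of_subset_of_nonneg (Finset.subset_univ _) fun p _ _ =>
          Finset.prod_nonneg fun k _ => hf0 _
    _ = ∏ k : Fin n, ∑ o, f o := by
        rw [Finset.prod_univ_sum, Fintype.piFinset_univ]
    _ = _ := by
        rw [Finset.prod_const, Finset.card_univ, Fintype.card_fin, Fintype.sum_option]
        simp [hf]

-- The same weighting for subsets, with the binomial theorem as the total weight.
open Classical in
lemma card_small_subsets_mul_le (N : ℕ) {x ρ : ℝ} (hx : 0 < x) (hx1 : x ≤ 1) :
    (((Finset.range N).powerset.filter fun A => (A.card : ℝ) ≤ ρ).card : ℝ) * x ^ ρ ≤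
      (1 + x) ^ N := by
  have h := Finset.sum_pow_mul_eq_add_pow x 1 (Finset.range N)
  simp only [one_pow, mul_one, Finset.card_range] at h
  rw [add_comm 1 x, ← h]
  calc _ = ∑ A ∈ (Finset.range N).powerset.filter fun A => (A.card : ℝ) ≤ ρ, x ^ ρ := by
        rw [Finset.sum_const, nsmul_eq_mul]
    _ ≤ ∑ A ∈ (Finset.range N).powerset.filter fun A => (A.card : ℝ) ≤ ρ, x ^ A.card :=
        Finset.sum_le_sum fun A hA => by
          rw [← Real.rpow_natCast]
          exact Real.rpow_le_rpow_of_exponent_ge hx hx1 (Finset.mem_filter.1 hA).2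
    _ ≤ _ := Finset.sum_le_sum_of_subset_of_nonneg (Finset.filter_subset _ _) fun A _ _ => by
        positivity

/-- A monotone function is determined on `range q` by the set of the numbers `c s + s`. -/
lemma eq_of_image_add_eq {c c' : ℕ → ℕ} (hc : Monotone c) (hc' : Monotone c') {q : ℕ}
    (h : (Finset.range q).image (fun s => c s + s) = (Finset.range q).image fun s => c' s + s)
    {s : ℕ} (hs : s < q) : c s = c' s := by
  have hmono : ∀ {c : ℕ → ℕ}, Monotone c → StrictMono fun s : Fin q => c s + s :=
    fun hc a b hab => add_lt_add_of_le_of_lt (hc hab.le) hab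
  have hr : ∀ c : ℕ → ℕ, range (fun s : Fin q => c s + s) =
      ((Finset.range q).image fun s => c s + s : Finset ℕ) := by
    intro c
    ext y
    simp only [mem_range, Finset.coe_image, Finset.coe_range, mem_image, mem_Iio]
    exact ⟨fun ⟨a, ha⟩ => ⟨a, a.2, ha⟩, fun ⟨a, ha, hy⟩ => ⟨⟨a, ha⟩, hy⟩⟩
  have := (StrictMono.range_inj (hmono hc) (hmono hc')).1 (by rw [hr, hr, h])
  have := congrFun this ⟨s, hs⟩
  simpa using this

open Classical in
/-- The number of almost self-similar words of length `n = r + q * T` grows slowly. -/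
lemma card_recurrent_words_mul_le (β : Type*) [Fintype β] {T q r n : ℕ} (hr : r < T)
    (hn : n = r + q * T) {ε x : ℝ} (hx : 0 < x) (hx1 : x ≤ 1) :
    ((Finset.univ.filter fun v : Fin n → β =>
      ∃ w, IsBlockRecurrent T ε q r w ∧ ∀ k : Fin n, v k = w (k + 1)).card : ℝ) *
      (x ^ ((ε + 2 / T) * n) * x ^ ((n : ℝ) / T)) ≤
      (1 + Fintype.card β * x) ^ n * (1 + x) ^ (2 * n) := by
  have hT : 0 < T := by omega
  have hTr : (0 : ℝ) < T := by exact_mod_cast hT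
  have hqn : q * T ≤ n := by omega
  have hqn' : q ≤ n := (Nat.le_mul_of_pos_right q hT).trans hqn
  have hqr : (q : ℝ) ≤ n / T := by rw [le_div_iff₀ hTr]; exact_mod_cast hqn
  set W := Finset.univ.filter fun v : Fin n → β =>
    ∃ w, IsBlockRecurrent T ε q r w ∧ ∀ k : Fin n, v k = w (k + 1) with hW
  set X := Finset.univ.filter fun p : Fin n → Option β =>
      ((Finset.univ.filter fun k => p k ≠ none).card : ℝ) ≤ (ε + 2 / T) * n with hX
  set Y := (Finset.range (n + q)).powerset.filter fun A => (A.card : ℝ) ≤ n / T with hY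
  have hcard : W.card ≤ (X ×ˢ Y).card := by
    -- A word is encoded by a partial word, with `none` at each letter to be copied, and by the set
    -- of the numbers `c s + s`, which encodes the shifts.
    refine Finset.card_le_card_of_forall_subsingleton (fun v z => ∃ c : ℕ → ℕ, Monotone c ∧
      z.2 = (Finset.range q).image (fun s => c s + s) ∧ ∀ k : Fin n, z.1 k = some (v k) ∨
        (z.1 k = none ∧ ((k : ℕ) - r) / T < q ∧ 1 ≤ c ((k - r) / T) ∧
          ∃ k' : Fin n, (k' : ℕ) + c ((k - r) / T) = k ∧ v k = v k')) ?_ ?_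
    · intro v hv
      obtain ⟨w, ⟨c, C, u, hc, hcle, hunc, hE, hF⟩, hvw⟩ := (Finset.mem_filter.1 hv).2
      -- Indices in `Fin n` start at `0`, digits at `1`: index `k` is digit `k + 1`, in block `(k -
      -- r) / T`. At a good index both copies agree with `u`, hence with each other.
      set good : ℕ → Prop := fun k => r ≤ k ∧ (k - r) / T ∈ C ∧ w (k + 1) = u (k + 1) ∧
        w (k + 1 - c ((k - r) / T)) = u (k + 1) with hgood
      have hblk : ∀ k, k < n → r ≤ k → (k - r) / T < q ∧ r + (k - r) / T * T ≤ k ∧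
          k < r + ((k - r) / T + 1) * T := by
        intro k hk hrk
        have s1 : (k - r) / T * T ≤ k - r := Nat.div_mul_le_self _ _
        have s2 : k - r < ((k - r) / T + 1) * T := by
          rw [mul_comm]; exact Nat.lt_mul_div_succ _ (by omega)
        refine ⟨?_, by omega, by omega⟩
        by_contra hge
        have := Nat.mul_le_mul_right T (not_lt.1 hge)
        omega
      refine ⟨(fun k => if good k then none else some (v k),
        (Finset.range q).image (fun s => c s + s)), ?_, c, hc, rfl, ?_⟩
      · rw [Finset.mem_product]
        constructor
        · refine Finset.mem_filter.2 ⟨Finset.mem_univ _, ?_⟩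
          set B := (Finset.range q).filter fun s => s ∉ C with hB
          have hBcard : (B.card : ℝ) + 1 ≤ ε * q := by
            convert hunc
            rw [← Set.ncard_coe_finset]
            congr 1
            ext s
            simp [hB]
          -- Letters are recorded only in the first `r` places, in uncovered blocks, and at no more
          -- than one error of each of the two kinds per block.
          have hsub : (Finset.univ.filter fun k : Fin n =>
              (if good k then none else some (v k)) ≠ none).image Fin.val ⊆
              (Finset.range r ∪ B.biUnion fun s => Finset.Ico (r + s * T) (r + (s + 1) * T)) ∪
              (Finset.range q).biUnion (fun s => (Finset.Ico (r + s * T) (r + (s + 1) * T)).filter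
                fun k => w (k + 1) ≠ u (k + 1)) ∪
              ((Finset.range q).filter fun s => s ∈ C).biUnion
                (fun s => (Finset.Ico (r + s * T) (r + (s + 1) * T)).filter
                fun k => w (k + 1 - c s) ≠ u (k + 1)) := by
            intro k hk
            obtain ⟨k, hkf, rfl⟩ := Finset.mem_image.1 hk
            have hng : ¬ good k := fun hg => (Finset.mem_filter.1 hkf).2 (if_pos hg)
            simp only [Finset.mem_union, Finset.mem_biUnion, Finset.mem_range, Finset.mem_filter,
              Finset.mem_Ico, hB]
            by_cases hrk : (k : ℕ) < r
            · exact Or.inl (Or.inl (Or.inl hrk))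
            obtain ⟨b1, b2, b3⟩ := hblk k k.2 (not_lt.1 hrk)
            by_cases hC : (k - r) / T ∈ C
            · by_cases h1 : w (k + 1) = u (k + 1)
              · refine Or.inr ⟨_, ⟨b1, hC⟩, ⟨b2, b3⟩, fun h2 => hng ⟨not_lt.1 hrk, hC, h1, h2⟩⟩
              · exact Or.inl (Or.inr ⟨_, b1, ⟨b2, b3⟩, h1⟩)
            · exact Or.inl (Or.inl (Or.inr ⟨_, ⟨b1, hC⟩, b2, b3⟩))
          have h0 := Finset.card_le_card hsub
          rw [Finset.card_image_of_injective _ Fin.val_injective] at h0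
          have h1 := h0.trans ((Finset.card_union_le _ _).trans (Nat.add_le_add_right
            ((Finset.card_union_le _ _).trans (Nat.add_le_add_right
              (Finset.card_union_le _ _) _)) _))
          have h2 := Finset.card_biUnion_le_card_mul B
            (fun s => Finset.Ico (r + s * T) (r + (s + 1) * T)) T fun s _ => by
              rw [Nat.card_Ico, add_mul]; omega
          have h3 := Finset.card_biUnion_le_card_mul (Finset.range q)
            (fun s => (Finset.Ico (r + s * T) (r + (s + 1) * T)).filter
                fun k => w (k + 1) ≠ u (k + 1)) 1 fun s hs => by
              have hsT := Nat.mul_le_mul_right T (Nat.succ_le_of_lt (Finset.mem_range.1 hs))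
              rw [Nat.succ_eq_add_one] at hsT
              refine Finset.card_le_one.2 fun a ha b hb => ?_
              simp only [Finset.mem_filter, Finset.mem_Ico, add_mul, one_mul] at ha hb hsT
              by_contra hne
              rcases lt_or_gt_of_ne hne with hlt | hlt
              · have := hE (a + 1) (b + 1) (by omega) (by omega) (by omega) ha.2 hb.2
                omega
              · have := hE (b + 1) (a + 1) (by omega) (by omega) (by omega) hb.2 ha.2
                omega
          have h4 := Finset.card_biUnion_le_card_mul ((Finset.range q).filter fun s => s ∈ C)
            (fun s => (Finset.Ico (r + s * T) (r + (s + 1) * T)).filter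
                fun k => w (k + 1 - c s) ≠ u (k + 1)) 1 fun s hs => by
              have hF' := (hF s (Finset.mem_filter.1 hs).2).2.2
              refine Finset.card_le_one.2 fun a ha b hb => ?_
              simp only [Finset.mem_filter, Finset.mem_Ico] at ha hb
              have hT' : (s + 1) * T = s * T + T := by rw [add_mul, one_mul]
              by_contra hne
              rcases lt_or_gt_of_ne hne with hlt | hlt
              · have := hF' (a + 1) (b + 1) (by omega) (by omega) (by omega) ha.2 hb.2
                omega
              · have := hF' (b + 1) (a + 1) (by omega) (by omega) (by omega) hb.2 ha.2
                omega
          have h5 : ((Finset.range q).filter fun s => s ∈ C).card ≤ q :=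
            (Finset.card_filter_le _ _).trans (Finset.card_range q).le
          rw [Finset.card_range] at h1 h3
          have h6 : (Finset.univ.filter fun k : Fin n =>
              (if good k then none else some (v k)) ≠ none).card ≤ r + B.card * T + 2 * q := by
            omega
          have h7 : ((Finset.univ.filter fun k : Fin n =>
              (if good k then none else some (v k)) ≠ none).card : ℝ) ≤
              r + B.card * T + 2 * q := by exact_mod_cast h6
          have hrr : (r : ℝ) ≤ T := by exact_mod_cast hr.le
          have h8 := mul_le_mul_of_nonneg_right hBcard hTr.le
          have hε : 0 ≤ ε * q := le_trans (by positivity) hBcard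
          have h9 : ε * q * T ≤ ε * n := by
            rcases Nat.eq_zero_or_pos q with h | h
            · rw [h] at hBcard
              have : (0 : ℝ) ≤ B.card := Nat.cast_nonneg _
              simp at hBcard
              linarith
            · have hq0 : (0 : ℝ) < q := by exact_mod_cast h
              have hε' : 0 ≤ ε := nonneg_of_mul_nonneg_left hε hq0
              rw [mul_assoc]
              exact mul_le_mul_of_nonneg_left (by exact_mod_cast hqn) hε'
          have h10 : 2 / (T : ℝ) * n = 2 * (n / T) := by ring
          rw [add_mul, h10]
          refine h7.trans ?_
          nlinarith
        · refine Finset.mem_filter.2 ⟨Finset.mem_powerset.2 ?_, ?_⟩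
          · intro y hy
            obtain ⟨s, hs, rfl⟩ := Finset.mem_image.1 hy
            rw [Finset.mem_range] at hs ⊢
            have h1 := hcle s
            have h2 := Nat.mul_le_mul_right T (Nat.succ_le_of_lt hs)
            rw [Nat.succ_eq_add_one] at h2
            omega
          · refine le_trans ?_ hqr
            exact_mod_cast Finset.card_image_le.trans (Finset.card_range q).le
      · intro k
        by_cases hg : good k
        · right
          obtain ⟨g1, g2, g3, g4⟩ := hg
          obtain ⟨b1, b2, b3⟩ := hblk k k.2 g1
          obtain ⟨f1, f2, -⟩ := hF _ g2
          have hk := k.2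
          refine ⟨if_pos ⟨g1, g2, g3, g4⟩, b1, f1, ⟨k - c ((k - r) / T), by omega⟩, ?_, ?_⟩
          · simp only
            omega
          · rw [hvw, hvw, g3, ← g4]
            congr 1
            simp only
            omega
        · exact Or.inl (if_neg hg)
    · rintro ⟨p, A⟩ - v ⟨-, c, hc, hA, hv⟩ v' ⟨-, c', hc', hA', hv'⟩
      simp only at hA hA' hv hv'
      have hcc : ∀ s, s < q → c s = c' s := fun s hs => eq_of_image_add_eq hc hc' (hA ▸ hA') hs
      -- Decoding: as shifts are at least `1`, a copied letter comes from a strictly earlier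
      -- position.
      have main : ∀ (m : ℕ) (hm : m < n), v ⟨m, hm⟩ = v' ⟨m, hm⟩ := by
        intro m
        induction m using Nat.strong_induction_on with
        | _ m ih =>
          intro hm
          rcases hv ⟨m, hm⟩ with h1 | ⟨h1, h2, h3, k, h4, h5⟩
          · rcases hv' ⟨m, hm⟩ with h1' | ⟨h1', -⟩
            · rw [h1] at h1'
              exact Option.some_injective _ h1'
            · rw [h1] at h1'
              simp at h1'
          · rcases hv' ⟨m, hm⟩ with h1' | ⟨h1', h2', h3', k', h4', h5'⟩
            · rw [h1] at h1'
              simp at h1'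
            · simp only at h2 h3 h4 h4'
              rw [← hcc _ h2] at h4'
              have hkk : k = k' := Fin.ext (by omega)
              rw [h5, h5', ← hkk]
              exact ih k (by omega) k.2
      funext k
      exact main k k.2
  have hYb := card_small_subsets_mul_le (n + q) (ρ := n / T) hx hx1
  have hXb := card_sparse_functions_mul_le β n (ρ := (ε + 2 / T) * n) hx hx1
  have hpow : (1 + x) ^ (n + q) ≤ (1 + x) ^ (2 * n) :=
    pow_le_pow_right₀ (by linarith) (by omega)
  calc _ ≤ ((X.card : ℝ) * Y.card) * (x ^ ((ε + 2 / T) * n) * x ^ ((n : ℝ) / T)) := by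
        refine mul_le_mul_of_nonneg_right ?_ (by positivity)
        rw [Finset.card_product] at hcard
        exact_mod_cast hcard
    _ = (X.card * x ^ ((ε + 2 / T) * n)) * (Y.card * x ^ ((n : ℝ) / T)) := by ring
    _ ≤ _ := mul_le_mul hXb (hYb.trans hpow) (by positivity) (by positivity)

/-! ## Angles -/

/-- The point of the circle with angle `t`, measured in full turns. -/
noncomputable def turn (t : ℝ) : Circle := Circle.exp (2 * Real.pi * t)

lemma turn_add_natCast (t : ℝ) (k : ℕ) : turn (k + t) = turn t := by
  unfold turn
  have h : Circle.exp (2 * Real.pi * k) = 1 := Circle.exp_eq_one.2 ⟨k, by push_cast; ring⟩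
  rw [mul_add, Circle.exp_add, h, one_mul]

lemma powMap_turn (d : ℕ) (t : ℝ) : powMap d (turn t) = turn (d * t) := by
  unfold powMap turn
  rw [← Circle.exp_nsmul, nsmul_eq_mul]
  congr 1
  ring

lemma angleDiff_one_turn {t : ℝ} (h0 : 0 ≤ t) (h1 : t < 1) :
    Circle.angleDiff 1 (turn t) = 2 * Real.pi * t := by
  have hpi := Real.two_pi_pos
  have := angleDiff_exp_exp (s := 0) (t := 2 * Real.pi * t) (by simp; positivity) (by nlinarith)
  simpa [turn] using this

lemma turn_inj {s t : ℝ} (hs : 0 ≤ s) (hs1 : s < 1) (ht : 0 ≤ t) (ht1 : t < 1)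
    (h : turn s = turn t) : s = t := by
  have h1 := angleDiff_one_turn hs hs1
  rw [h, angleDiff_one_turn ht ht1] at h1
  exact (mul_left_cancel₀ Real.two_pi_pos.ne' h1).symm

lemma exists_turn_eq (z : Circle) : ∃ t : ℝ, 0 ≤ t ∧ t < 1 ∧ turn t = z := by
  have hpi := Real.two_pi_pos
  refine ⟨Circle.angleDiff 1 z / (2 * Real.pi), div_nonneg (Circle.angleDiff_nonneg _ _) hpi.le,
    (div_lt_one hpi).2 (Circle.angleDiff_lt_two_pi _ _), ?_⟩
  unfold turn
  rw [mul_div_cancel₀ _ hpi.ne']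
  simpa using Circle.exp_angleDiff_mul (x := 1) (y := z)

/-- The letter of a point and the position of its image relative to `α` determine the first digit of
the point in the number system with base `d`. -/
lemma digit_of_letter {d : ℕ} (hd : 2 ≤ d) {θ y y' : ℝ} {k : ℕ} {i : Fin d} (hθ0 : 0 ≤ θ)
    (hθ1 : θ < 1) (hy0 : 0 ≤ y) (hy1 : y < 1) (hy0' : 0 ≤ y') (hy1' : y' < 1)
    (hk : d * y = k + y') (hi : letter d (turn θ) (turn y) = some i) :
    (θ < y' → k = i) ∧ (y' < θ → k = (i + 1) % d) := by
  have hpi := Real.two_pi_pos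
  have hdr : (2 : ℝ) ≤ d := by exact_mod_cast hd
  have hd0 : (0 : ℝ) < d := by linarith
  have hid := i.2
  have hkd : k < d := by
    have : (k : ℝ) < d := by nlinarith
    exact_mod_cast this
  have hθd : θ / d * d = θ := div_mul_cancel₀ _ hd0.ne'
  have hθd0 : 0 ≤ θ / d := by positivity
  have hθd1 : θ / d < 1 := by rw [div_lt_one hd0]; linarith
  rw [letter_eq_some_iff hd] at hi
  have hbase := angleDiff_one_turn hθ0 hθ1
  rcases le_or_gt (θ / d) y with h | h
  · have e : turn y = Circle.exp (Circle.angleDiff 1 (turn θ) / d + 2 * Real.pi * (y - θ / d)) := by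
      rw [hbase]; unfold turn; congr 1; ring
    rw [e, exp_mem_sector_iff hd _ _ (by nlinarith) (by nlinarith)] at hi
    have e2 : (d : ℝ) * (2 * Real.pi * (y - θ / d)) = 2 * Real.pi * (k + y' - θ) := by
      rw [← hk]; nlinarith
    rw [e2] at hi
    have a1 := lt_of_mul_lt_mul_left hi.1 hpi.le
    have a2 := lt_of_mul_lt_mul_left hi.2 hpi.le
    constructor
    · intro hlt
      have b1 : ((i : ℕ) : ℝ) < k + 1 := by linarith
      have b2 : (k : ℝ) < (i : ℕ) + 1 := by linarith
      have c1 : (i : ℕ) < k + 1 := by exact_mod_cast b1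
      have c2 : k < i + 1 := by exact_mod_cast b2
      omega
    · intro hlt
      have b1 : ((i : ℕ) : ℝ) < k := by linarith
      have b2 : (k : ℝ) < (i : ℕ) + 2 := by linarith
      have c1 : (i : ℕ) < k := by exact_mod_cast b1
      have c2 : k < i + 2 := by exact_mod_cast b2
      have : k = i + 1 := by omega
      rw [← this, Nat.mod_eq_of_lt hkd]
  -- Here `y` precedes the first root, so `turn y` lies in the last sector, which wraps past `1`; a
  -- full turn is added to measure its angle.
  · have hlt : d * y < θ := by nlinarith
    have hk0 : k = 0 := by
      have : (k : ℝ) < 1 := by linarith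
      have : k < 1 := by exact_mod_cast this
      omega
    subst hk0
    rw [Nat.cast_zero, zero_add] at hk
    have e : turn y =
        Circle.exp (Circle.angleDiff 1 (turn θ) / d + 2 * Real.pi * (y - θ / d + 1)) := by
      rw [hbase, ← turn_add_natCast y 1]; unfold turn; congr 1; push_cast; ring
    rw [e, exp_mem_sector_iff hd _ _ (by nlinarith) (by nlinarith)] at hi
    have e2 : (d : ℝ) * (2 * Real.pi * (y - θ / d + 1)) = 2 * Real.pi * (y' - θ + d) := by
      rw [← hk]; nlinarith
    rw [e2] at hi
    have a2 := lt_of_mul_lt_mul_left hi.2 hpi.le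
    refine ⟨fun h' => by linarith, fun _ => ?_⟩
    have b1 : (d : ℝ) < (i : ℕ) + 2 := by linarith
    have c1 : d < i + 2 := by exact_mod_cast b1
    have : (i : ℕ) + 1 = d := by omega
    rw [this, Nat.mod_self]

/-- A superset of the first `v.length` base `d` digits (read as one number) of the points whose
itinerary begins with `v`, where `pre k` stands for the first `k` digits of `α`. -/
def codes (d : ℕ) (pre : ℕ → ℕ) : List (Option (Fin d)) → Finset ℕ
  | [] => {0}
  | none :: v => (Finset.range d).image fun k => pre v.length + d ^ v.length * k
  | some i :: v => insert (pre v.length + d ^ v.length * ((i + 1) % d))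
      ((codes d pre v).image fun p =>
        p + d ^ v.length * (if pre v.length ≤ p then (i : ℕ) else (i + 1) % d))

/-- Once the tail is known to lie on one side of `α`, a letter fixes the leading digit. Only a tail
code equal to the prefix of `α` leaves two choices, which costs one extra code per letter. The
letter `⋆` makes the tail equal to that prefix and leaves `d` digits. Growth is thus linear in the
length. -/
lemma card_codes_le {d : ℕ} (hd : 2 ≤ d) (pre : ℕ → ℕ) (v : List (Option (Fin d))) :
    (codes d pre v).card ≤ v.length + d := by
  induction v with
  | nil => simp only [codes, Finset.card_singleton, List.length_nil]; omega
  | cons o v ih =>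
    rw [List.length_cons]
    cases o with
    | none =>
      have := Finset.card_image_le (s := Finset.range d)
        (f := fun k => pre v.length + d ^ v.length * k)
      rw [Finset.card_range] at this
      rw [codes]
      omega
    | some i =>
      rw [codes]
      have h1 := Finset.card_insert_le (pre v.length + d ^ v.length * ((i + 1) % d))
        ((codes d pre v).image fun p =>
          p + d ^ v.length * (if pre v.length ≤ p then (i : ℕ) else (i + 1) % d))
      have h2 := Finset.card_image_le (s := codes d pre v)
        (f := fun p => p + d ^ v.length * (if pre v.length ≤ p then (i : ℕ) else (i + 1) % d))
      omega

lemma floor_mem_codes {d : ℕ} (hd : 2 ≤ d) {θ : ℝ} (hθ0 : 0 ≤ θ) (hθ1 : θ < 1) (pre : ℕ → ℕ)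
    (v : List (Option (Fin d))) (hpre : ∀ k < v.length, pre k = ⌊(d : ℝ) ^ k * θ⌋₊)
    {y : ℝ} (hy0 : 0 ≤ y) (hy1 : y < 1)
    (hv : ∀ (k : ℕ) (hk : k < v.length), v[k] = itinerary d (turn θ) (turn y) (k + 1)) :
    ⌊(d : ℝ) ^ v.length * y⌋₊ ∈ codes d pre v := by
  have hdr : (2 : ℝ) ≤ d := by exact_mod_cast hd
  induction v generalizing y with
  | nil => simp [codes, Nat.floor_eq_zero.2 hy1]
  | cons o v ih =>
    set k := ⌊(d : ℝ) * y⌋₊ with hk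
    set y' := (d : ℝ) * y - k with hy'
    have hdy : 0 ≤ (d : ℝ) * y := by positivity
    have hy0' : 0 ≤ y' := sub_nonneg.2 (Nat.floor_le hdy)
    have hy1' : y' < 1 := by have := Nat.lt_floor_add_one ((d : ℝ) * y); linarith
    have hkd : k < d := (Nat.floor_lt hdy).2 (by nlinarith)
    have hdk : (d : ℝ) * y = k + y' := by ring
    have himg : powMap d (turn y) = turn y' := by rw [powMap_turn, hdk, turn_add_natCast]
    have hfloor : ⌊(d : ℝ) ^ (v.length + 1) * y⌋₊ = ⌊(d : ℝ) ^ v.length * y'⌋₊ + d ^ v.length * k := by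
      rw [← Nat.floor_add_natCast (by positivity)]
      congr 1
      push_cast
      rw [pow_succ, mul_assoc, hdk]
      ring
    have hmem : ⌊(d : ℝ) ^ v.length * y'⌋₊ ∈ codes d pre v := by
      refine ih (fun j hj => hpre j (by simp; omega)) hy0' hy1' fun j hj => ?_
      have := hv (j + 1) (by simp; omega)
      rw [List.getElem_cons_succ] at this
      rw [this]
      unfold itinerary
      rw [Nat.add_sub_cancel, Nat.add_sub_cancel, iterate_succ_apply, himg]
    have hpv := hpre v.length (by simp)
    have ho : o = letter d (turn θ) (turn y) := by
      have := hv 0 (by simp)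
      simpa [itinerary] using this
    rw [List.length_cons, hfloor]
    cases o with
    | none =>
      have h1 := (letter_eq_none_iff hd _ _).1 ho.symm
      rw [himg] at h1
      have h2 := turn_inj hy0' hy1' hθ0 hθ1 h1
      rw [codes, Finset.mem_image]
      exact ⟨k, Finset.mem_range.2 hkd, by rw [hpv, h2]⟩
    | some i =>
      have h1 := digit_of_letter hd hθ0 hθ1 hy0 hy1 hy0' hy1' hdk ho.symm
      have hne : y' ≠ θ := by
        intro he
        have := (letter_eq_none_iff hd (turn θ) (turn y)).2 (by rw [himg, he])
        rw [this] at ho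
        simp at ho
      rw [codes, Finset.mem_insert, Finset.mem_image]
      rcases lt_or_gt_of_ne hne with hlt | hlt
      · rw [h1.2 hlt]
        -- Truncation can hide the strict inequality `y' < θ`; that tie is the inserted code.
        by_cases hle : pre v.length ≤ ⌊(d : ℝ) ^ v.length * y'⌋₊
        · left
          have : ⌊(d : ℝ) ^ v.length * y'⌋₊ ≤ pre v.length := by
            rw [hpv]
            exact Nat.floor_mono (mul_le_mul_of_nonneg_left hlt.le (by positivity))
          rw [le_antisymm hle this]
        · exact Or.inr ⟨_, hmem, by rw [if_neg hle]⟩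
      · right
        refine ⟨_, hmem, ?_⟩
        rw [h1.1 hlt, if_pos]
        rw [hpv]
        exact Nat.floor_mono (mul_le_mul_of_nonneg_left hlt.le (by positivity))

/-- A superset of the first `r + B + t * B` base `d` digits (read as one number) of the points `α`
whose own itinerary begins like `w`. -/
def heads (d B r : ℕ) (w : ℕ → Option (Fin d)) : ℕ → Finset ℕ
  | 0 => Finset.range (d ^ (r + B))
  | t + 1 => (heads d B r w t).biUnion fun g =>
      (codes d (fun k => g / d ^ (r + B + t * B - k))
        (List.ofFn fun k : Fin B => w (r + B + t * B + k + 1))).image fun p => p + d ^ B * g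

/-- The next `B` digits of `α` are the first `B` digits of its image after `r + B + t * B` steps.
The prefixes of `α` needed for their codes are shorter than `B` and can be read off the digits
already found, so `B` digits cost only a factor `B + d`. -/
lemma card_heads_le {d : ℕ} (hd : 2 ≤ d) (B r : ℕ) (w : ℕ → Option (Fin d)) (t : ℕ) :
    (heads d B r w t).card ≤ d ^ (r + B) * (B + d) ^ t := by
  induction t with
  | zero => simp [heads]
  | succ t ih =>
    rw [heads, pow_succ, ← mul_assoc]
    refine (Finset.card_biUnion_le_card_mul _ _ (B + d) fun g _ => ?_).trans
      (Nat.mul_le_mul_right _ ih)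
    refine Finset.card_image_le.trans ((card_codes_le hd _ _).trans ?_)
    rw [List.length_ofFn]

lemma iterate_powMap_turn (d : ℕ) (θ : ℝ) (m : ℕ) :
    (powMap d)^[m] (turn θ) = turn ((d : ℝ) ^ m * θ - ⌊(d : ℝ) ^ m * θ⌋₊) := by
  have h1 : (powMap d)^[m] (turn θ) = turn ((d : ℝ) ^ m * θ) := by
    induction m with
    | zero => simp
    | succ m ih => rw [iterate_succ_apply', ih, powMap_turn, pow_succ']; ring_nf
  have h2 := turn_add_natCast ((d : ℝ) ^ m * θ - ⌊(d : ℝ) ^ m * θ⌋₊) ⌊(d : ℝ) ^ m * θ⌋₊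
  rw [h1, ← h2]
  congr 1
  ring

lemma floor_mem_heads {d : ℕ} (hd : 2 ≤ d) {θ : ℝ} (hθ0 : 0 ≤ θ) (hθ1 : θ < 1) (B r : ℕ)
    (w : ℕ → Option (Fin d)) (t : ℕ)
    (hw : ∀ m, 1 ≤ m → m ≤ r + B + t * B → w m = itinerary d (turn θ) (turn θ) m) :
    ⌊(d : ℝ) ^ (r + B + t * B) * θ⌋₊ ∈ heads d B r w t := by
  have hdr : (2 : ℝ) ≤ d := by exact_mod_cast hd
  induction t with
  | zero =>
    rw [heads, Finset.mem_range, Nat.floor_lt (by positivity)]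
    push_cast
    rw [zero_mul, add_zero]
    have : (0 : ℝ) < (d : ℝ) ^ (r + B) := by positivity
    nlinarith
  | succ t ih =>
    set m := r + B + t * B with hm
    have hm' : r + B + (t + 1) * B = B + m := by rw [hm]; ring
    have hg := ih fun j h1 h2 => hw j h1 (by omega)
    set g := ⌊(d : ℝ) ^ m * θ⌋₊ with hgdef
    set y := (d : ℝ) ^ m * θ - g with hy
    have h0 : (0 : ℝ) ≤ (d : ℝ) ^ m * θ := by positivity
    have hy0 : 0 ≤ y := sub_nonneg.2 (Nat.floor_le h0)
    have hy1 : y < 1 := by have := Nat.lt_floor_add_one ((d : ℝ) ^ m * θ); linarith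
    rw [heads, Finset.mem_biUnion]
    refine ⟨g, hg, Finset.mem_image.2 ⟨⌊(d : ℝ) ^ B * y⌋₊, ?_, ?_⟩⟩
    · have := floor_mem_codes hd hθ0 hθ1 (fun k => g / d ^ (m - k))
        (List.ofFn fun k : Fin B => w (m + k + 1)) ?_ hy0 hy1 ?_
      · rwa [List.length_ofFn] at this
      · intro k hk
        rw [List.length_ofFn] at hk
        -- Division by `d ^ (m - k)` keeps the leading `k` of the `m` digits; `k < B ≤ m`.
        rw [hgdef, ← Nat.floor_div_natCast]
        congr 1
        push_cast
        rw [← pow_sub_mul_pow (d : ℝ) (show k ≤ m by omega)]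
        field_simp
      · intro k hk
        rw [List.length_ofFn] at hk
        rw [List.getElem_ofFn, hw _ (by omega) (by omega), hy, hgdef, ← iterate_powMap_turn,
          itinerary_iterate _ _ _ _ (by omega)]
        rfl
    · rw [hm', ← Nat.floor_add_natCast (by positivity)]
      congr 1
      push_cast
      rw [pow_add]
      ring

/-! ## Hausdorff dimension -/

/-- `x` is the weight in the Chernoff bounds, `δ` the tolerated proportion of uncovered blocks, and
`B` the number of digits decoded at once; each is chosen to cost at most a factor `l` per digit. -/
lemma exists_growth_parameters (a : ℝ) (ha : 0 ≤ a) (d : ℕ) {l : ℝ} (hl : 1 < l) :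
    ∃ (x δ : ℝ) (B : ℕ), 0 < x ∧ x ≤ 1 ∧ (1 + a * x) * (1 + x) ^ 2 ≤ l ∧ 0 < δ ∧
      l⁻¹ ≤ x ^ (2 * δ) ∧ 0 < B ∧ (B + d : ℝ) ≤ l ^ B := by
  set x : ℝ := min (1 / 2) ((l - 1) / (4 * a + 3)) with hx
  have hx0 : 0 < x := lt_min (by norm_num) (div_pos (by linarith) (by linarith))
  have hx1 : x ≤ 1 / 2 := min_le_left _ _
  have hx2 : x * (4 * a + 3) ≤ l - 1 := (le_div_iff₀ (by linarith)).1 (min_le_right _ _)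
  have hlogx : Real.log x < 0 := Real.log_neg hx0 (by linarith)
  have hlogl : 0 < Real.log l := Real.log_pos hl
  have hlim := tendsto_pow_const_div_const_pow_of_one_lt 1 hl
  obtain ⟨B, hB1, hB2⟩ := ((hlim.eventually_le_const (show (0 : ℝ) < 1 / 2 by norm_num)).and
    (Filter.eventually_ge_atTop (d + 1))).exists
  refine ⟨x, Real.log l / (-(2 * Real.log x)), B, hx0, by linarith, ?_,
    div_pos hlogl (by linarith), ?_, by omega, ?_⟩
  · have h1 : (1 + x) ^ 2 ≤ 1 + 3 * x := by nlinarith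
    have h2 : (1 + a * x) * (1 + x) ^ 2 ≤ (1 + a * x) * (1 + 3 * x) :=
      mul_le_mul_of_nonneg_left h1 (by positivity)
    have h3 : a * x * x ≤ a * x * (1 / 2) := mul_le_mul_of_nonneg_left hx1 (by positivity)
    nlinarith [mul_nonneg ha hx0.le]
  · refine le_of_eq ?_
    rw [Real.rpow_def_of_pos hx0]
    have : Real.log x * (2 * (Real.log l / (-(2 * Real.log x)))) = -Real.log l := by
      have := hlogx.ne
      field_simp
    rw [this, Real.exp_neg, Real.exp_log (by linarith)]
  · rw [pow_one, div_le_iff₀ (by positivity)] at hB1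
    have : (d : ℝ) + 1 ≤ B := by exact_mod_cast hB2
    linarith

open Classical in
/-- The points violating the semi-CCE condition are covered by few `d`-adic intervals. -/
lemma exists_digit_cover {d : ℕ} (hd : 2 ≤ d) {l : ℝ} (hl : 1 < l) :
    ∃ K : ℝ, 0 ≤ K ∧ ∃ T₀ : ℕ, ∀ T, T₀ ≤ T → ∃ F : ℕ → Finset ℕ,
      (∀ n, ((F n).card : ℝ) ≤ K * (l ^ 3) ^ n) ∧ (∀ n, n < T → F n = ∅) ∧
      ∀ θ : ℝ, 0 ≤ θ → θ < 1 → ¬ SemiCCE d (turn θ) → ∃ n, ⌊(d : ℝ) ^ n * θ⌋₊ ∈ F n := by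
  obtain ⟨x, δ, B, hx0, hx1, hxl, hδ, hδl, hB0, hB⟩ :=
    exists_growth_parameters (d + 1) (by positivity) d hl
  obtain ⟨T₁, hT₁⟩ := exists_nat_ge (3 / δ)
  -- The constant counts the fewer than `2 * B` free initial digits and does not depend on `T`. The
  -- bound `T ≥ 3 / δ` makes the recorded letters and shifts cost at most `2 * δ * n` in the
  -- exponent; `T ≥ B` leaves room for the free digits.
  refine ⟨(d : ℝ) ^ (2 * B), by positivity, max (max T₁ B) 1, fun T hT => ?_⟩
  have hTT : T₁ ≤ T := by omega
  have hTB : B ≤ T := by omega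
  have hT0 : 0 < T := by omega
  have hTr : (0 : ℝ) < T := by exact_mod_cast hT0
  have hTδ : 3 / (T : ℝ) ≤ δ := by
    have : (T₁ : ℝ) ≤ T := by exact_mod_cast hTT
    rw [div_le_iff₀ hTr]
    rw [div_le_iff₀ hδ] at hT₁
    nlinarith
  set W : ∀ n : ℕ, Finset (Fin n → Option (Fin d)) := fun n => Finset.univ.filter fun v =>
    ∃ w, IsBlockRecurrent T δ (n / T) (n % T) w ∧ ∀ k : Fin n, v k = w (k + 1) with hW
  set ext : ∀ n : ℕ, (Fin n → Option (Fin d)) → ℕ → Option (Fin d) := fun n v m =>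
    if h : m - 1 < n then v ⟨m - 1, h⟩ else none with hext
  refine ⟨fun n => if n < T then ∅ else
    (W n).biUnion fun v => heads d B (n % B) (ext n v) (n / B - 1), ?_, ?_, ?_⟩
  · intro n
    dsimp only
    split_ifs with hn
    · simp only [Finset.card_empty, Nat.cast_zero]
      positivity
    have hnB : 1 ≤ n / B := (Nat.one_le_div_iff hB0).2 (by omega)
    have hcard : ((W n).biUnion fun v => heads d B (n % B) (ext n v) (n / B - 1)).card ≤
        (W n).card * (d ^ (2 * B) * (B + d) ^ (n / B)) := by
      refine Finset.card_biUnion_le_card_mul _ _ _ fun v _ => (card_heads_le hd _ _ _ _).trans ?_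
      have := Nat.mod_lt n hB0
      exact Nat.mul_le_mul (Nat.pow_le_pow_right (by omega) (by omega))
        (Nat.pow_le_pow_right (by omega) (by omega))
    have hwords : ((W n).card : ℝ) ≤ (l ^ 2) ^ n := by
      have h1 := card_recurrent_words_mul_le (Option (Fin d)) (Nat.mod_lt n hT0)
        (show n = n % T + n / T * T by rw [mul_comm, Nat.mod_add_div]) (ε := δ) hx0 hx1
      rw [Fintype.card_option, Fintype.card_fin, pow_mul, ← mul_pow, ← Real.rpow_add hx0] at h1
      push_cast at h1
      have hexp : (δ + 2 / T) * n + (n : ℝ) / T ≤ 2 * δ * n := by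
        have : (δ + 2 / T) * n + (n : ℝ) / T = (δ + 3 / T) * n := by ring
        rw [this]
        exact mul_le_mul_of_nonneg_right (by linarith) (Nat.cast_nonneg _)
      have h2 : l⁻¹ ^ n ≤ x ^ ((δ + 2 / T) * n + (n : ℝ) / T) := by
        refine le_trans ?_ (Real.rpow_le_rpow_of_exponent_ge hx0 hx1 hexp)
        rw [Real.rpow_mul hx0.le, Real.rpow_natCast]
        exact pow_le_pow_left₀ (by positivity) hδl n
      have h3 : ((W n).card : ℝ) * l⁻¹ ^ n ≤ l ^ n :=
        (mul_le_mul_of_nonneg_left h2 (Nat.cast_nonneg _)).trans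
          (h1.trans (pow_le_pow_left₀ (by positivity) hxl n))
      rw [inv_pow, ← div_eq_mul_inv, div_le_iff₀ (by positivity)] at h3
      calc _ ≤ _ := h3
        _ = _ := by ring
    have hpow : ((B + d : ℝ)) ^ (n / B) ≤ l ^ n :=
      calc ((B + d : ℝ)) ^ (n / B) ≤ (l ^ B) ^ (n / B) := pow_le_pow_left₀ (by positivity) hB _
        _ = l ^ (B * (n / B)) := (pow_mul _ _ _).symm
        _ ≤ l ^ n := pow_le_pow_right₀ hl.le (Nat.mul_div_le _ _)
    calc _ ≤ ((W n).card : ℝ) * ((d : ℝ) ^ (2 * B) * (B + d : ℝ) ^ (n / B)) := by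
          exact_mod_cast hcard
      _ ≤ (l ^ 2) ^ n * ((d : ℝ) ^ (2 * B) * l ^ n) := by gcongr
      _ = _ := by ring
  · intro n hn
    exact if_pos hn
  · intro θ hθ0 hθ1 hθ
    obtain ⟨q, r, hq, hr, hrec⟩ := exists_isBlockRecurrent hd hθ hT0 hδ
    set n := r + q * T with hn
    have hnq : n / T = q := by
      rw [hn, Nat.add_mul_div_right _ _ hT0, Nat.div_eq_of_lt hr, zero_add]
    have hnr : n % T = r := by rw [hn, Nat.add_mul_mod_self_right, Nat.mod_eq_of_lt hr]
    have hTn : T ≤ n := (Nat.le_mul_of_pos_left T hq).trans (Nat.le_add_left _ _)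
    refine ⟨n, ?_⟩
    dsimp only
    rw [if_neg (by omega), Finset.mem_biUnion]
    set v : Fin n → Option (Fin d) := fun k => itinerary d (turn θ) (turn θ) (k + 1) with hv
    refine ⟨v, Finset.mem_filter.2 ⟨Finset.mem_univ _, _, by rw [hnq, hnr]; exact hrec,
      fun k => rfl⟩, ?_⟩
    have hnB : 1 ≤ n / B := (Nat.one_le_div_iff hB0).2 (by omega)
    have hnB' : n % B + B + (n / B - 1) * B = n := by
      obtain ⟨t, ht⟩ : ∃ t, n / B = t + 1 := ⟨n / B - 1, by omega⟩
      have := Nat.mod_add_div n B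
      rw [ht] at this ⊢
      rw [Nat.add_sub_cancel]
      linarith
    have := floor_mem_heads hd hθ0 hθ1 B (n % B) (ext n v) (n / B - 1) fun m h1 h2 => by
      rw [hnB'] at h2
      simp only [hext, hv]
      rw [dif_pos (by omega), Nat.sub_add_cancel h1]
    rwa [hnB'] at this

-- The covers use only levels `n ≥ T`, so their meshes tend to zero, and for every `s > 0` their
-- `s`-dimensional sums are tails of a geometric series.
open MeasureTheory in
lemma dimH_angles_eq_zero {d : ℕ} (hd : 2 ≤ d) :
    dimH {θ : ℝ | 0 ≤ θ ∧ θ < 1 ∧ ¬ SemiCCE d (turn θ)} = 0 := by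
  set A := {θ : ℝ | 0 ≤ θ ∧ θ < 1 ∧ ¬ SemiCCE d (turn θ)} with hA
  have hdr : (2 : ℝ) ≤ d := by exact_mod_cast hd
  have hd0 : (0 : ℝ) < d := by linarith
  suffices h : ∀ s : NNReal, 0 < s → dimH A ≤ s by
    refine le_antisymm (ENNReal.le_of_forall_pos_le_add fun ε hε _ => ?_) bot_le
    rw [zero_add]
    exact h ε hε
  intro s hs
  have hs' : (0 : ℝ) < s := hs
  refine dimH_le_of_hausdorffMeasure_ne_top ?_
  -- An interval of level `n` contributes `l ^ (-5 * n)`, against `l ^ (3 * n)` intervals up to a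
  -- constant. Of the remaining `l ^ (-2 * n)`, one factor sums over `n` and the other gives decay
  -- in `T`.
  set l : ℝ := (d : ℝ) ^ ((s : ℝ) / 5) with hl
  have hl1 : 1 < l := Real.one_lt_rpow (by linarith) (by positivity)
  have hl0 : 0 < l := by linarith
  have hl5 : l ^ 5 = (d : ℝ) ^ (s : ℝ) := by
    rw [hl, ← Real.rpow_natCast, ← Real.rpow_mul hd0.le]
    congr 1
    push_cast
    ring
  have hlinv : l⁻¹ < 1 := inv_lt_one_of_one_lt₀ hl1
  obtain ⟨K, hK, T₀, hcov⟩ := exists_digit_cover hd hl1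
  choose! F hF1 hF2 hF3 using hcov
  set t : ∀ T : ℕ, (Σ n : ℕ, F T n) → Set ℝ := fun T p =>
    Icc ((p.2 : ℕ) / (d : ℝ) ^ p.1) (((p.2 : ℕ) + 1) / (d : ℝ) ^ p.1) with ht
  have hdiam : ∀ T p, Metric.ediam (t T p) = ENNReal.ofReal ((d : ℝ)⁻¹ ^ p.1) := fun T p => by
    simp only [ht]
    rw [Real.ediam_Icc]
    congr 1
    rw [inv_pow]
    ring
  have hdinv : (d : ℝ)⁻¹ < 1 := inv_lt_one_of_one_lt₀ (by linarith)
  have hbound := Measure.hausdorffMeasure_le_liminf_tsum (s : ℝ) A (l := Filter.atTop)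
    (fun T : ℕ => ENNReal.ofReal ((d : ℝ)⁻¹ ^ T)) ?_ t ?_ ?_
  rotate_left
  · have := ENNReal.tendsto_ofReal (tendsto_pow_atTop_nhds_zero_of_lt_one
      (inv_nonneg.2 hd0.le) hdinv)
    rwa [ENNReal.ofReal_zero] at this
  · filter_upwards [Filter.eventually_ge_atTop T₀] with T hT
    rintro ⟨n, g, hg⟩
    rw [hdiam]
    refine ENNReal.ofReal_le_ofReal (pow_le_pow_of_le_one (inv_nonneg.2 hd0.le) hdinv.le ?_)
    by_contra hlt
    rw [hF2 T hT n (not_le.1 hlt)] at hg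
    simp at hg
  · filter_upwards [Filter.eventually_ge_atTop T₀] with T hT
    rintro θ ⟨h0, h1, h2⟩
    obtain ⟨n, hn⟩ := hF3 T hT θ h0 h1 h2
    refine mem_iUnion.2 ⟨⟨n, _, hn⟩, ?_, ?_⟩
    · rw [div_le_iff₀ (by positivity)]
      dsimp only
      rw [mul_comm θ]
      exact Nat.floor_le (by positivity)
    · rw [le_div_iff₀ (by positivity), mul_comm θ]
      exact (Nat.lt_floor_add_one _).le
  have hsum : ∀ T, T₀ ≤ T → ∑' p, Metric.ediam (t T p) ^ (s : ℝ) ≤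
      ENNReal.ofReal (K * l⁻¹ ^ T * (1 - l⁻¹)⁻¹) := by
    intro T hT
    have hterm : ∀ n, ∑' g : F T n, Metric.ediam (t T ⟨n, g⟩) ^ (s : ℝ) ≤
        ENNReal.ofReal (K * l⁻¹ ^ T * l⁻¹ ^ n) := by
      intro n
      have h1 : ((d : ℝ)⁻¹ ^ n) ^ (s : ℝ) = (l⁻¹ ^ 5) ^ n := by
        rw [← Real.rpow_natCast, ← Real.rpow_mul (inv_nonneg.2 hd0.le), mul_comm,
          Real.rpow_mul (inv_nonneg.2 hd0.le), Real.rpow_natCast, Real.inv_rpow hd0.le, ← hl5,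
          inv_pow, inv_pow, inv_pow]
      simp only [hdiam]
      rw [ENNReal.ofReal_rpow_of_nonneg (by positivity) hs'.le, h1, tsum_fintype,
        Finset.sum_const, Finset.card_univ, Fintype.card_coe, nsmul_eq_mul,
        ← ENNReal.ofReal_natCast, ← ENNReal.ofReal_mul (Nat.cast_nonneg _)]
      refine ENNReal.ofReal_le_ofReal ?_
      rcases lt_or_ge n T with hn | hn
      · rw [hF2 T hT n hn]
        simp only [Finset.card_empty, Nat.cast_zero, zero_mul]
        positivity
      · have h2 : (l⁻¹ : ℝ) ^ n ≤ l⁻¹ ^ T := pow_le_pow_of_le_one (by positivity) hlinv.le hn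
        calc ((F T n).card : ℝ) * (l⁻¹ ^ 5) ^ n ≤ K * (l ^ 3) ^ n * (l⁻¹ ^ 5) ^ n := by
              gcongr
              exact hF1 T hT n
          _ = K * l⁻¹ ^ n * l⁻¹ ^ n * (l * l⁻¹) ^ (3 * n) := by ring
          _ = K * l⁻¹ ^ n * l⁻¹ ^ n := by
              rw [mul_inv_cancel₀ hl0.ne', one_pow, mul_one]
          _ ≤ _ := by gcongr
    rw [ENNReal.tsum_sigma']
    refine (ENNReal.tsum_le_tsum hterm).trans (le_of_eq ?_)
    rw [← ENNReal.ofReal_tsum_of_nonneg (fun n => by positivity)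
      ((summable_geometric_of_lt_one (by positivity) hlinv).mul_left _), tsum_mul_left,
      tsum_geometric_of_lt_one (by positivity) hlinv]
  have hlim : Filter.Tendsto (fun T : ℕ => ENNReal.ofReal (K * l⁻¹ ^ T * (1 - l⁻¹)⁻¹))
      Filter.atTop (nhds 0) := by
    have := ENNReal.tendsto_ofReal (((tendsto_pow_atTop_nhds_zero_of_lt_one
      (by positivity) hlinv).const_mul K).mul_const (1 - l⁻¹)⁻¹)
    simpa using this
  refine ne_top_of_le_ne_top ENNReal.zero_ne_top (hbound.trans ?_)
  rw [← hlim.liminf_eq]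
  exact Filter.liminf_le_liminf ((Filter.eventually_ge_atTop T₀).mono hsum)

lemma lipschitzWith_turn : LipschitzWith (2 * NNReal.pi) turn := by
  refine LipschitzWith.of_dist_le_mul fun s t => ?_
  have h : ((turn s : Circle) : ℂ) - turn t =
      turn t * (Complex.exp (Complex.I * ((2 * Real.pi * (s - t) : ℝ) : ℂ)) - 1) := by
    simp only [turn, Circle.coe_exp]
    rw [mul_sub, ← Complex.exp_add, mul_one]
    congr 2
    push_cast
    ring
  rw [show dist (turn s) (turn t) = dist (turn s : ℂ) (turn t) from rfl, dist_eq_norm, h, norm_mul, Circle.norm_coe, one_mul]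
  refine Real.norm_exp_I_mul_ofReal_sub_one_le.trans (le_of_eq ?_)
  rw [norm_mul, Real.dist_eq, Real.norm_eq_abs, Real.norm_eq_abs, abs_of_pos Real.two_pi_pos]
  simp

/-- The parametrization by angles is Lipschitz and hence does not raise the dimension. -/
theorem dimH_not_semiCCE {d : ℕ} (hd : 2 ≤ d) : dimH {α : Circle | ¬ SemiCCE d α} = 0 := by
  refine le_antisymm ?_ bot_le
  rw [← dimH_angles_eq_zero hd]
  refine (dimH_mono ?_).trans (lipschitzWith_turn.dimH_image_le _)
  intro α hα
  obtain ⟨θ, h0, h1, rfl⟩ := exists_turn_eq α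
  exact ⟨θ, ⟨h0, h1, hα⟩, rfl⟩

end UnicriticalLamination

theorem mainTheorem3 (d : ℕ) (hd : 2 ≤ d) :
    (∀ α : Circle, ¬ UnicriticalLamination.IsPreperiodic d α →
      ¬ UnicriticalLamination.SemiCCE d α → UnicriticalLamination.StronglyRecurrent d α) ∧
    dimH {α : Circle | ¬ UnicriticalLamination.SemiCCE d α} = 0 := by
  exact ⟨fun α _ h => UnicriticalLamination.stronglyRecurrent_of_not_semiCCE hd h,
    UnicriticalLamination.dimH_not_semiCCE hd⟩
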